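/- Let $\mathsf D$ be an exact category in the sense of Quillen (with short exact sequences $X\hookrightarrow Y\twoheadrightarrow Z$, admissible monics $X\hookrightarrow Y$ and admissible epics $Y\twoheadrightarrow Z$), let $\mathsf C\subset\mathsf D$ be an extension-closed full additive subcategory (hence itself an exact category), and let $\kappa$ be an infinite cardinal. For an exact category $\mathsf E$ let $\mathrm{Lex}(\mathsf E)$ be the abelian category of left exact presheaves, i.e. of functors $F\colon\mathsf E^{op}\to\mathsf{Ab}$ for which $0\to F(Z)\to F(Y)\to F(X)$ is exact for every short exact sequence $X\hookrightarrow Y\twoheadrightarrow Z$; $\mathsf E$ embeds in it by the Yoneda embedding. An admissible Ind diagram in $\mathsf E$ is a functor $X\colon I\to\mathsf E$ on a directed (nonempty) partially ordered set $I$ with $|I|\le\kappa$ such that every $X_i\to X_j$, $i\le j$, is an admissible monic. Let $\mathsf{Ind}^a_\kappa(\mathsf E)\subset\mathrm{Lex}(\mathsf E)$ be the full subcategory of the objects that are isomorphic to the colimit of an admissible Ind diagram; its short exact sequences are those of $\mathrm{Lex}(\mathsf E)$ with all terms in it. Put $\mathsf{Pro}^a_\kappa(\mathsf E)=(\mathsf{Ind}^a_\kappa(\mathsf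 E^{op}))^{op}$. For a full subcategory $\mathsf C\subset\mathsf E$ let $\mathsf{Ind}^a_\kappa(\mathsf E,\mathsf C)\subset\mathsf{Ind}^a_\kappa(\mathsf E)$ be the full subcategory of the colimits of those admissible Ind diagrams for which $X_j/X_i\in\mathsf C$ for all $i<j$ (up to isomorphism), with the inherited short exact sequences. The category of relative elementary Tate objects is $$\mathsf{Tate}^{el}_\kappa(\mathsf D,\mathsf C)=\mathsf{Ind}^a_\kappa(\mathsf{Pro}^a_\kappa(\mathsf D),\mathsf C).$$ It contains $\mathsf{Pro}^a_\kappa(\mathsf D)$ and $\mathsf{Ind}^a_\kappa(\mathsf C)$ as full subcategories. Let $V\in\mathsf{Tate}^{el}_\kappa(\mathsf D,\mathsf C)$. A relative lattice of $V$ is an admissible monic $L\hookrightarrow V$ in $\mathsf{Tate}^{el}_\kappa(\mathsf D,\mathsf C)$ with $L\in\mathsf{Pro}^a_\kappa(\mathsf D)$ and $V/L\in\mathsf{Ind}^a_\kappa(\mathsf C)$; relative lattices are considered up to isomorphism over $V$, i.e. as subobjects of $V$. Write $L\le L'$ if $L\hookrightarrow V$ factors through $L'\hookrightarrow V$ via an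 admissible monic $L\hookrightarrow L'$. The relative Sato Grassmannian $Gr_{\mathsf C}(V)$ is the set of relative lattices of $V$ with the relation $\le$. **Proposition.** If $\mathsf D$ is idempotent complete, then for every $V\in\mathsf{Tate}^{el}_\kappa(\mathsf D,\mathsf C)$ the relative Sato Grassmannian $Gr_{\mathsf C}(V)$ is a directed partially ordered set: $Gr_{\mathsf C}(V)$ is nonempty, $\le$ is a partial order on it, and any two relative lattices $L_1,L_2$ of $V$ have a common upper bound, i.e. there is a relative lattice $L$ of $V$ with $L_1\le L$ and $L_2\le L$. -/

import Mathlib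

open CategoryTheory CategoryTheory.Limits Opposite

universe v u

noncomputable section

namespace RelTate

/-! ### Exact categories -/

/-- A category with a distinguished class of composable pairs `X ⟶ Y ⟶ Z`, the *conflations*
(or short exact sequences). The axioms of an exact category are in `QuillenExact`. -/
class HasConflations (E : Type u) [Category.{v} E] where
  /-- the pair `f, g` is a conflation -/
  conflation : ∀ ⦃X Y Z : E⦄, (X ⟶ Y) → (Y ⟶ Z) → Prop

section Conflations

variable {E : Type u} [Category.{v} E] [HasConflations E]

/-- `X ⟶ Y ⟶ Z` is a conflation (a short exact sequence of the exact structure). -/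
def Conflation {X Y Z : E} (f : X ⟶ Y) (g : Y ⟶ Z) : Prop :=
  HasConflations.conflation f g

/-- Admissible monics. -/
def AdmMono {X Y : E} (f : X ⟶ Y) : Prop :=
  ∃ (Z : E) (g : Y ⟶ Z), Conflation f g

/-- Admissible epics. -/
def AdmEpi {Y Z : E} (g : Y ⟶ Z) : Prop :=
  ∃ (X : E) (f : X ⟶ Y), Conflation f g

/-- The opposite class of conflations. -/
instance : HasConflations Eᵒᵖ where
  conflation _ _ _ f g := Conflation g.unop f.unop

/-- The class of conflations that a full subcategory inherits from the ambient category. -/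
instance (P : ObjectProperty E) : HasConflations P.FullSubcategory where
  conflation _ _ _ f g := Conflation f.hom g.hom

end Conflations

/-- `f` is a kernel of `g` and `g` is a cokernel of `f`. -/
def IsKernelCokernelPair {E : Type u} [Category.{v} E] [HasZeroMorphisms E] {X Y Z : E}
    (f : X ⟶ Y) (g : Y ⟶ Z) : Prop :=
  ∃ w : f ≫ g = 0, Nonempty (IsLimit (KernelFork.ofι f w)) ∧
    Nonempty (IsColimit (CokernelCofork.ofπ g w))

/-- Exact categories in the sense of Quillen: an additive category with a class of
kernel-cokernel pairs, closed under isomorphisms, that satisfies the usual axioms. -/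
class QuillenExact (E : Type u) [Category.{v} E] [Preadditive E] [HasConflations E] : Prop where
  hasZeroObject : HasZeroObject E
  hasBinaryBiproducts : HasBinaryBiproducts E
  isKernelCokernelPair : ∀ {X Y Z : E} {f : X ⟶ Y} {g : Y ⟶ Z},
    Conflation f g → IsKernelCokernelPair f g
  of_iso : ∀ {X Y Z X' Y' Z' : E} {f : X ⟶ Y} {g : Y ⟶ Z} {f' : X' ⟶ Y'} {g' : Y' ⟶ Z'}
    (a : X ≅ X') (b : Y ≅ Y') (c : Z ≅ Z'), f ≫ b.hom = a.hom ≫ f' → g ≫ c.hom = b.hom ≫ g' →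
    Conflation f g → Conflation f' g'
  admMono_id : ∀ X : E, AdmMono (𝟙 X)
  admEpi_id : ∀ X : E, AdmEpi (𝟙 X)
  admMono_comp : ∀ {X Y Z : E} (f : X ⟶ Y) (g : Y ⟶ Z), AdmMono f → AdmMono g → AdmMono (f ≫ g)
  admEpi_comp : ∀ {X Y Z : E} (f : X ⟶ Y) (g : Y ⟶ Z), AdmEpi f → AdmEpi g → AdmEpi (f ≫ g)
  exists_pushout : ∀ {X Y X' : E} (f : X ⟶ Y) (a : X ⟶ X'), AdmMono f →
    ∃ (Y' : E) (b : Y ⟶ Y') (f' : X' ⟶ Y'), IsPushout f a b f' ∧ AdmMono f'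
  exists_pullback : ∀ {Y Z Z' : E} (g : Y ⟶ Z) (c : Z' ⟶ Z), AdmEpi g →
    ∃ (Y' : E) (b : Y' ⟶ Y) (g' : Y' ⟶ Z'), IsPullback b g' g c ∧ AdmEpi g'

section Opposite

variable {E : Type u} [Category.{v} E]

theorem admMono_op_iff [HasConflations E] {X Y : Eᵒᵖ} (f : X ⟶ Y) :
    AdmMono f ↔ AdmEpi f.unop :=
  ⟨fun ⟨Z, g, h⟩ => ⟨Z.unop, g.unop, h⟩, fun ⟨Z, g, h⟩ => ⟨op Z, g.op, h⟩⟩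

theorem admEpi_op_iff [HasConflations E] {X Y : Eᵒᵖ} (f : X ⟶ Y) :
    AdmEpi f ↔ AdmMono f.unop :=
  ⟨fun ⟨Z, g, h⟩ => ⟨Z.unop, g.unop, h⟩, fun ⟨Z, g, h⟩ => ⟨op Z, g.op, h⟩⟩

theorem isKernelCokernelPair_op [Preadditive E] {X Y Z : E} {f : X ⟶ Y} {g : Y ⟶ Z}
    (h : IsKernelCokernelPair f g) : IsKernelCokernelPair g.op f.op := by
  obtain ⟨w, ⟨hf⟩, ⟨hg⟩⟩ := h
  exact ⟨by rw [← op_comp, w]; rfl,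
    ⟨CokernelCofork.IsColimit.ofπOp g w hg⟩, ⟨KernelFork.IsLimit.ofιOp f w hf⟩⟩

/-- The opposite of an exact category is exact. -/
instance [Preadditive E] [HasConflations E] [h : QuillenExact E] : QuillenExact Eᵒᵖ where
  hasZeroObject := by
    have := h.hasZeroObject
    infer_instance
  hasBinaryBiproducts := by
    have := h.hasBinaryBiproducts
    infer_instance
  isKernelCokernelPair {_ _ _ f g} hfg :=
    isKernelCokernelPair_op (h.isKernelCokernelPair (f := g.unop) (g := f.unop) hfg)
  of_iso a b c h₁ h₂ hfg :=
    h.of_iso c.symm.unop b.symm.unop a.symm.unop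
      (Quiver.Hom.op_inj ((Iso.inv_comp_eq b).2
        ((Category.assoc _ _ _).symm.trans ((Iso.comp_inv_eq c).2 h₂.symm)).symm))
      (Quiver.Hom.op_inj ((Iso.inv_comp_eq a).2
        ((Category.assoc _ _ _).symm.trans ((Iso.comp_inv_eq b).2 h₁.symm)).symm)) hfg
  admMono_id X := (admMono_op_iff _).2 (h.admEpi_id X.unop)
  admEpi_id X := (admEpi_op_iff _).2 (h.admMono_id X.unop)
  admMono_comp f g hf hg := (admMono_op_iff _).2
    (h.admEpi_comp _ _ ((admMono_op_iff g).1 hg) ((admMono_op_iff f).1 hf))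
  admEpi_comp f g hf hg := (admEpi_op_iff _).2
    (h.admMono_comp _ _ ((admEpi_op_iff g).1 hg) ((admEpi_op_iff f).1 hf))
  exists_pushout f a hf := by
    obtain ⟨Y', b, g', hp, hg⟩ := h.exists_pullback f.unop a.unop ((admMono_op_iff f).1 hf)
    exact ⟨op Y', b.op, g'.op, hp.op.flip, (admMono_op_iff _).2 hg⟩
  exists_pullback f a hf := by
    obtain ⟨Y', b, g', hp, hg⟩ := h.exists_pushout f.unop a.unop ((admEpi_op_iff f).1 hf)
    exact ⟨op Y', b.op, g'.op, hp.op.flip, (admEpi_op_iff _).2 hg⟩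

end Opposite

/-- An extension-closed (full, additive) subcategory of an exact category, given by the property of
belonging to it. (Closure under isomorphisms and under finite direct sums follows.) -/
structure IsExtensionClosed {E : Type u} [Category.{v} E] [Preadditive E] [HasConflations E]
    (C : ObjectProperty E) : Prop where
  zero : ∀ Z : E, IsZero Z → C Z
  extension : ∀ {X Y Z : E} (f : X ⟶ Y) (g : Y ⟶ Z), Conflation f g → C X → C Z → C Y

/-! ### Left exact presheaves and admissible Ind objects -/

section Ind

variable (E : Type u) [Category.{v} E] [HasConflations E]

/-- A presheaf of abelian groups is left exact if it takes every conflation `X ⟶ Y ⟶ Z` to an exact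
sequence `0 ⟶ F Z ⟶ F Y ⟶ F X`. -/
def isLeftExact : ObjectProperty (Eᵒᵖ ⥤ AddCommGrpCat.{v}) := fun F =>
  ∀ ⦃X Y Z : E⦄ (f : X ⟶ Y) (g : Y ⟶ Z), Conflation f g →
    Function.Injective (F.map g.op) ∧ Function.Exact (F.map g.op) (F.map f.op)

/-- The category of left exact presheaves. -/
abbrev Lex : Type (max u (v + 1)) := (isLeftExact E).FullSubcategory

/-- The exact structure of the abelian category `Lex E`: its short exact sequences. -/
instance : HasConflations (Lex E) where
  conflation _ _ _ f g := IsKernelCokernelPair f g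

/-- Admissible Ind diagrams of size at most `κ`: functors on a directed (nonempty) partially
ordered set with at most `κ` elements, all of whose transition maps are admissible monics. -/
structure AdmIndDiagram (κ : Cardinal.{v}) where
  I : Type v
  [partialOrder : PartialOrder I]
  [isDirected : IsDirectedOrder I]
  [nonempty : Nonempty I]
  card_le : Cardinal.mk I ≤ κ
  X : I ⥤ E
  admMono : ∀ {i j : I} (h : i ⟶ j), AdmMono (X.map h)

attribute [instance] AdmIndDiagram.partialOrder AdmIndDiagram.isDirected AdmIndDiagram.nonempty

variable {E} [Preadditive E]

/-- The presheaf `F` is a colimit of the representable presheaves of the objects of the diagram `X`.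
(If `I` is filtered then this colimit is left exact, hence it is also the colimit in `Lex E`.) -/
def IsColimitOf {I : Type*} [Category I] (X : I ⥤ E) (F : Eᵒᵖ ⥤ AddCommGrpCat.{v}) : Prop :=
  ∃ c : X ⋙ preadditiveYoneda ⟶ (Functor.const I).obj F, Nonempty (IsColimit (Cocone.mk F c))

variable (E)

/-- Left exact presheaves that are colimits of admissible Ind diagrams of size at most `κ`. -/
def isAdmInd (κ : Cardinal.{v}) : ObjectProperty (Lex E) := fun F =>
  ∃ S : AdmIndDiagram E κ, IsColimitOf S.X F.obj

/-- The exact category of admissible Ind objects, a full subcategory of `Lex E`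
with the inherited conflations. -/
abbrev IndObj (κ : Cardinal.{v}) : Type (max u (v + 1)) := (isAdmInd E κ).FullSubcategory

variable {E}

/-- Relative admissible Ind objects: those that are the colimit of an admissible Ind diagram with
`X j / X i` in the subcategory `C` for all `i < j`. -/
def isRelAdmInd (κ : Cardinal.{v}) (C : ObjectProperty E) : ObjectProperty (IndObj E κ) := fun F =>
  ∃ S : AdmIndDiagram E κ, IsColimitOf S.X F.obj.obj ∧
    ∀ (i j : S.I) (h : i < j),
      ∃ (Q : E) (q : S.X.obj j ⟶ Q), Conflation (S.X.map (homOfLE h.le)) q ∧ C Q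

/-- The exact category of relative admissible Ind objects. -/
abbrev RelIndObj (κ : Cardinal.{v}) (C : ObjectProperty E) : Type (max u (v + 1)) :=
  (isRelAdmInd κ C).FullSubcategory

end Ind

section Embedding

variable (E : Type u) [Category.{v} E] [Preadditive E] [HasConflations E] [QuillenExact E]

theorem isLeftExact_preadditiveYoneda (A : E) : isLeftExact E (preadditiveYoneda.obj A) := by
  intro X Y Z f g hfg
  obtain ⟨w, -, ⟨hg⟩⟩ := QuillenExact.isKernelCokernelPair hfg
  refine ⟨fun a b hab => ?_, fun y => ⟨fun hy => ?_, ?_⟩⟩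
  · exact Cofork.IsColimit.hom_ext hg hab
  · obtain ⟨l, hl⟩ := CokernelCofork.IsColimit.desc' hg y hy
    exact ⟨l, hl⟩
  · rintro ⟨z, rfl⟩
    exact (Category.assoc f g _).symm.trans ((congrArg (fun t => t ≫ _) w).trans zero_comp)

/-- The embedding of `E` into left exact presheaves. -/
def toLex : E ⥤ Lex E :=
  (isLeftExact E).lift preadditiveYoneda (isLeftExact_preadditiveYoneda E)

theorem isAdmInd_toLex (κ : Cardinal.{v}) [hκ : Fact (Cardinal.aleph0 ≤ κ)] (A : E) :
    isAdmInd E κ ((toLex E).obj A) := by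
  let S : AdmIndDiagram E κ :=
    { I := PUnit
      card_le := by
        rw [Cardinal.mk_fintype, Fintype.card_punit, Nat.cast_one]
        exact Cardinal.one_le_aleph0.trans hκ.out
      X := (Functor.const _).obj A
      admMono := fun _ => QuillenExact.admMono_id A }
  let c : S.X ⋙ preadditiveYoneda ⟶ (Functor.const S.I).obj (preadditiveYoneda.obj A) :=
    { app := fun _ => 𝟙 (preadditiveYoneda.obj A)
      naturality := fun _ _ _ => congrArg (· ≫ 𝟙 _) (preadditiveYoneda.map_id A) }
  exact ⟨S, c, ⟨
    { desc := fun s => s.ι.app PUnit.unit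
      fac := fun s _ => Category.id_comp (s.ι.app PUnit.unit)
      uniq := fun s m hm => (Category.id_comp m).symm.trans (hm PUnit.unit) }⟩⟩

/-- The embedding of `E` into its category of admissible Ind objects. -/
def toInd (κ : Cardinal.{v}) [Fact (Cardinal.aleph0 ≤ κ)] : E ⥤ IndObj E κ :=
  (isAdmInd E κ).lift (toLex E) (isAdmInd_toLex E κ)

end Embedding

/-! ### Admissible Pro objects, relative elementary Tate objects, and relative lattices -/

section Tate

variable (D : Type u) [Category.{v} D] [Preadditive D] [HasConflations D]

/-- The exact category of admissible Pro objects, the opposite of the admissible Ind objects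
of the opposite category. -/
abbrev ProObj (κ : Cardinal.{v}) : Type (max u (v + 1)) := (IndObj Dᵒᵖ κ)ᵒᵖ

variable [QuillenExact D]

/-- The embedding of `D` into its category of admissible Pro objects. -/
def toPro (κ : Cardinal.{v}) [Fact (Cardinal.aleph0 ≤ κ)] : D ⥤ ProObj D κ :=
  opOp D ⋙ (toInd Dᵒᵖ κ).op

variable {D}

/-- The exact category of relative elementary Tate objects: the relative admissible Ind objects of
the pair formed by `Pro D` and (the essential image of) its full subcategory `C`. -/
abbrev ElTate (κ : Cardinal.{v}) [Fact (Cardinal.aleph0 ≤ κ)] (C : ObjectProperty D) :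
    Type (max (u + 1) (v + 1)) :=
  RelIndObj.{max u v, max u (v + 1)} (E := ProObj D κ) (Cardinal.lift.{u} κ) (C.map (toPro D κ))

variable {κ : Cardinal.{v}} [Fact (Cardinal.aleph0 ≤ κ)] {C : ObjectProperty D}

/-- The presheaf on `Pro D` that underlies a relative elementary Tate object. -/
abbrev ElTate.presheaf (V : ElTate κ C) : (ProObj D κ)ᵒᵖ ⥤ AddCommGrpCat.{max u v} :=
  V.obj.obj.obj

/-- `V` belongs to the full subcategory `Pro D`: it is isomorphic to a representable presheaf. -/
def ElTate.IsPro (V : ElTate κ C) : Prop :=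
  ∃ P : ProObj D κ, Nonempty (preadditiveYoneda.obj P ≅ V.presheaf)

/-- `V` belongs to the full subcategory `Ind C`: it is the colimit of an admissible Ind diagram in
the exact category `C`. -/
def ElTate.IsIndSub (V : ElTate κ C) : Prop :=
  ∃ S : AdmIndDiagram C.FullSubcategory κ, IsColimitOf (S.X ⋙ C.ι ⋙ toPro D κ) V.presheaf

/-- An admissible monic `i : L ⟶ V` is a relative lattice if `L` is in `Pro D` and the quotient
`V / L` is in `Ind C`. -/
def IsRelLattice {L V : ElTate κ C} (i : L ⟶ V) : Prop :=
  L.IsPro ∧ ∃ (Q : ElTate κ C) (q : V ⟶ Q), Conflation i q ∧ Q.IsIndSub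

/-- The relative Sato Grassmannian: the relative lattices of `V`, as subobjects of `V`
(i.e. up to isomorphism over `V`). -/
def SatoGr (V : ElTate κ C) : Type (max (u + 1) (v + 1)) :=
  { L : Subobject V // IsRelLattice L.arrow }

/-- `L ≤ L'` if the inclusion of `L` factors through that of `L'` via an admissible monic. -/
def SatoGr.le {V : ElTate κ C} (L L' : SatoGr V) : Prop :=
  ∃ f : (L.1 : ElTate κ C) ⟶ (L'.1 : ElTate κ C), AdmMono f ∧ f ≫ L'.1.arrow = L.1.arrow

end Tate

end RelTate

end

universe w

set_option linter.unusedSectionVars false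

open scoped ZeroObject

noncomputable section

namespace RelTate

/-! ### Elementary facts about exact categories -/

section Exact

variable {E : Type u} [Category.{v} E] [HasConflations E]

/-! Write `V` as the directed union of its pieces X_i in Pro(D), with all X_j/X_i in `C`. Three
facts give the theorem. (1) Each piece is a relative lattice: V/X_i is the union of the X_j/X_i with
j ≥ i, an Ind object of `C` (`exists_quotient_union`, `isIndSub_of_isUnion`,
`exists_lattice_diagram`). (2) A lattice is representable as a presheaf on Pro(D), so by Yoneda its
inclusion is a section of the union `V`, and this section already lies in some X_i, hence in all
later ones. (3) A morphism of lattices over `V` is automatically an admissible monic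
(`admMono_of_isRelLattice`). Hence the relation on lattices is the order of subobjects
(`SatoGr.le_iff`), and by (2) a common piece bounds any two lattices.

Idempotent completeness enters only through (3). Let L ⊂ A be lattices and U = A/L, the kernel of
V/L → V/A. Since A is representable, A → V/L lands in a piece c in `C`. Let B ⊂ V be the preimage of
c, an extension of c by L that contains A, and put T = A ⊔_L B. The map x ↦ (x, -x) sends U to T,
and the map T → c that vanishes on B takes it back to the inclusion U ⊂ c. As T is a Pro object and
c lies in `D`, T → c factors through an epic T → w with w in `D` (`exists_toPro_factorization`). The
image of w in V/L still dies in V/A, so w maps to U and U is a retract of w (`exists_retract`).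
Splitting the idempotent of w in `D` shows that U is an object of `D`, so A/L exists in Pro(D).

This argument takes pushouts and pullbacks in Pro(D), which must therefore be known to be exact.
Left exact presheaves are handled through their sections, with admissible epics in the role of
coverings: short exactness becomes `LexExact`, and extensions of Ind objects are straightened into
diagrams of conflations (`LexExact.exists_indPres`). -/

theorem Conflation.op {X Y Z : E} {f : X ⟶ Y} {g : Y ⟶ Z} (h : Conflation f g) :
    Conflation g.op f.op := h

variable [Preadditive E] [QuillenExact E]

instance : HasZeroObject E := QuillenExact.hasZeroObject

namespace Conflation

variable {X Y Z : E} {f : X ⟶ Y} {g : Y ⟶ Z}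

theorem zero (h : Conflation f g) : f ≫ g = 0 :=
  (QuillenExact.isKernelCokernelPair h).1

theorem mono (h : Conflation f g) : Mono f := by
  obtain ⟨w, ⟨hf⟩, -⟩ := QuillenExact.isKernelCokernelPair h
  exact ⟨fun a b hab => Fork.IsLimit.hom_ext hf hab⟩

theorem epi (h : Conflation f g) : Epi g := by
  obtain ⟨w, -, ⟨hg⟩⟩ := QuillenExact.isKernelCokernelPair h
  exact ⟨fun a b hab => Cofork.IsColimit.hom_ext hg hab⟩

theorem lift (h : Conflation f g) {A : E} (t : A ⟶ Y) (ht : t ≫ g = 0) :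
    ∃ s : A ⟶ X, s ≫ f = t := by
  obtain ⟨w, ⟨hf⟩, -⟩ := QuillenExact.isKernelCokernelPair h
  obtain ⟨l, hl⟩ := KernelFork.IsLimit.lift' hf t ht
  exact ⟨l, hl⟩

theorem desc (h : Conflation f g) {A : E} (t : Y ⟶ A) (ht : f ≫ t = 0) :
    ∃ s : Z ⟶ A, g ≫ s = t := by
  obtain ⟨w, -, ⟨hg⟩⟩ := QuillenExact.isKernelCokernelPair h
  obtain ⟨l, hl⟩ := CokernelCofork.IsColimit.desc' hg t ht
  exact ⟨l, hl⟩

end Conflation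

theorem AdmMono.mono {X Y : E} {f : X ⟶ Y} (h : AdmMono f) : Mono f := by
  obtain ⟨_, _, h⟩ := h
  exact h.mono

/-- A cokernel of an admissible monic completes it to a conflation. -/
theorem Conflation.of_cokernel {X Y Z : E} {f : X ⟶ Y} {g : Y ⟶ Z} (hf : AdmMono f)
    (w : f ≫ g = 0) (he : Epi g)
    (hd : ∀ {A : E} (t : Y ⟶ A), f ≫ t = 0 → ∃ s : Z ⟶ A, g ≫ s = t) : Conflation f g := by
  obtain ⟨Z', g', h⟩ := hf
  have := h.epi
  obtain ⟨c, hc⟩ := h.desc g w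
  obtain ⟨d, hd⟩ := hd g' h.zero
  refine QuillenExact.of_iso (Iso.refl _) (Iso.refl _)
    (⟨c, d, ?_, ?_⟩ : Z' ≅ Z) (by simp) (by simpa using hc) h
  · rw [← cancel_epi g', reassoc_of% hc, hd, Category.comp_id]
  · rw [← cancel_epi g, reassoc_of% hd, hc, Category.comp_id]

/-- A kernel of an admissible epic completes it to a conflation. -/
theorem Conflation.of_kernel {X Y Z : E} {f : X ⟶ Y} {g : Y ⟶ Z} (hg : AdmEpi g)
    (w : f ≫ g = 0) (hm : Mono f)
    (hl : ∀ {A : E} (t : A ⟶ Y), t ≫ g = 0 → ∃ s : A ⟶ X, s ≫ f = t) : Conflation f g := by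
  obtain ⟨X', f', h⟩ := hg
  have := h.mono
  obtain ⟨c, hc⟩ := h.lift f w
  obtain ⟨d, hd⟩ := hl f' h.zero
  refine QuillenExact.of_iso (⟨d, c, ?_, ?_⟩ : X' ≅ X) (Iso.refl _) (Iso.refl _)
    (by simpa using hd.symm) (by simp) h
  · rw [← cancel_mono f', Category.assoc, hc, hd, Category.id_comp]
  · rw [← cancel_mono f, Category.assoc, hd, hc, Category.id_comp]

theorem AdmMono.of_isPushout {X Y X' Y' : E} {f : X ⟶ Y} {a : X ⟶ X'} {b : Y ⟶ Y'}
    {f' : X' ⟶ Y'} (h : IsPushout f a b f') (hf : AdmMono f) : AdmMono f' := by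
  obtain ⟨Y₁, b₁, f₁, h₁, Z, g, hg⟩ := QuillenExact.exists_pushout f a hf
  refine ⟨Z, (h.isoIsPushout _ _ h₁).hom ≫ g, QuillenExact.of_iso (Iso.refl _)
    (h₁.isoIsPushout _ _ h) (Iso.refl _) ?_ ?_ hg⟩
  · simp
  · simp only [Iso.refl_hom, Category.comp_id]
    rw [← Iso.inv_comp_eq]
    congr 1

/-- The pushout of a conflation. -/
theorem Conflation.exists_pushout {X Y Z X' : E} {f : X ⟶ Y} {g : Y ⟶ Z} (h : Conflation f g)
    (a : X ⟶ X') : ∃ (Y' : E) (b : Y ⟶ Y') (f' : X' ⟶ Y') (g' : Y' ⟶ Z),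
      IsPushout f a b f' ∧ Conflation f' g' ∧ b ≫ g' = g := by
  obtain ⟨Y', b, f', hp, hf'⟩ := QuillenExact.exists_pushout f a ⟨Z, g, h⟩
  have := h.epi
  have hb : b ≫ hp.desc g 0 (by simp [h.zero]) = g := hp.inl_desc _ _ _
  refine ⟨Y', b, f', hp.desc g 0 (by simp [h.zero]), hp, ?_, hb⟩
  refine Conflation.of_cokernel hf' (hp.inr_desc _ _ _) (epi_of_epi_fac hb) fun t ht => ?_
  obtain ⟨s, hs⟩ := h.desc (b ≫ t) (by rw [hp.w_assoc, ht, comp_zero])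
  refine ⟨s, hp.hom_ext ?_ ?_⟩
  · rw [reassoc_of% hb, hs]
  · rw [hp.inr_desc_assoc, zero_comp, ht]

/-- The pullback of a conflation. -/
theorem Conflation.exists_pullback {X Y Z Z' : E} {f : X ⟶ Y} {g : Y ⟶ Z} (h : Conflation f g)
    (c : Z' ⟶ Z) : ∃ (Y' : E) (b : Y' ⟶ Y) (f' : X ⟶ Y') (g' : Y' ⟶ Z'),
      IsPullback b g' g c ∧ Conflation f' g' ∧ f' ≫ b = f := by
  obtain ⟨Y', b, f', g', hp, hc, hb⟩ := h.op.exists_pushout c.op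
  exact ⟨Y'.unop, b.unop, g'.unop, f'.unop, hp.unop.flip, hc, Quiver.Hom.op_inj hb⟩

theorem AdmEpi.exists_lift {W Z A : E} {p : W ⟶ Z} (hp : AdmEpi p) (z : A ⟶ Z) :
    ∃ (B : E) (q : B ⟶ A) (t : B ⟶ W), AdmEpi q ∧ t ≫ p = q ≫ z := by
  obtain ⟨B, t, q, h, hq⟩ := QuillenExact.exists_pullback p z hp
  exact ⟨B, q, t, hq, h.w⟩

theorem AdmEpi.id (A : E) : AdmEpi (𝟙 A) := QuillenExact.admEpi_id A

theorem AdmEpi.comp {X Y Z : E} {f : X ⟶ Y} {g : Y ⟶ Z} (hf : AdmEpi f) (hg : AdmEpi g) :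
    AdmEpi (f ≫ g) := QuillenExact.admEpi_comp f g hf hg

theorem AdmMono.id (A : E) : AdmMono (𝟙 A) := QuillenExact.admMono_id A

theorem AdmMono.comp {X Y Z : E} {f : X ⟶ Y} {g : Y ⟶ Z} (hf : AdmMono f) (hg : AdmMono g) :
    AdmMono (f ≫ g) := QuillenExact.admMono_comp f g hf hg

/-- An admissible monic pulls back to an admissible monic along an admissible epic. -/
theorem AdmMono.of_isPullback {Y Z Y' Z' : E} {b : Y' ⟶ Y} {g' : Y' ⟶ Z'} {g : Y ⟶ Z}
    {c : Z' ⟶ Z} (h : IsPullback b g' g c) (hg : AdmEpi g) (hc : AdmMono c) : AdmMono b := by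
  obtain ⟨T, d, hd⟩ := hc
  have := hd.mono
  -- As `c` is the kernel of `d`, its pullback along `g` is the kernel of the admissible epic `g ≫
  -- d`.
  refine ⟨T, g ≫ d, Conflation.of_kernel (hg.comp ⟨_, _, hd⟩) ?_ ⟨fun s t hst => ?_⟩ fun t ht => ?_⟩
  · rw [h.w_assoc, hd.zero, comp_zero]
  · refine h.hom_ext hst ?_
    rw [← cancel_mono c, Category.assoc, Category.assoc, ← h.w, reassoc_of% hst]
  · obtain ⟨s, hs⟩ := hd.lift (t ≫ g) (by rw [Category.assoc, ht])
    exact ⟨h.lift t s hs.symm, h.lift_fst _ _ _⟩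

/-- The short five lemma. -/
theorem Conflation.isIso_of_ends {X Y Y' Z : E} {f : X ⟶ Y} {g : Y ⟶ Z} {f' : X ⟶ Y'}
    {g' : Y' ⟶ Z} (h : Conflation f g) (h' : Conflation f' g') {m : Y ⟶ Y'} (hf : f ≫ m = f')
    (hg : m ≫ g' = g) : IsIso m := by
  have := h'.mono
  have hm : Mono m := by
    refine Preadditive.mono_of_cancel_zero _ fun t ht => ?_
    obtain ⟨s, rfl⟩ := h.lift t (by rw [← hg, reassoc_of% ht, zero_comp])
    have : s = 0 := by rw [← cancel_mono f', zero_comp, ← hf, ← Category.assoc, ht]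
    rw [this, zero_comp]
  -- The inverse is built locally: over the cover `q` of `Y'` a lift to `Y` exists, a correction
  -- from `X` makes it exact, and since `m` is monic the corrected lift kills the kernel of `q` and
  -- descends.
  obtain ⟨B, q, t, hq, ht⟩ := AdmEpi.exists_lift ⟨X, f, h⟩ g'
  obtain ⟨s, hs⟩ := h'.lift (t ≫ m - q) (by rw [Preadditive.sub_comp, Category.assoc, hg, ht,
    sub_self])
  have e : (t - s ≫ f) ≫ m = q := by
    rw [Preadditive.sub_comp, Category.assoc, hf, hs, sub_sub_cancel]
  obtain ⟨K, k, hk⟩ := hq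
  have := hk.epi
  obtain ⟨r, hr⟩ := hk.desc (t - s ≫ f) (by
    rw [← cancel_mono m, Category.assoc, e, hk.zero, zero_comp])
  have h1 : r ≫ m = 𝟙 _ := by rw [← cancel_epi q, reassoc_of% hr, e, Category.comp_id]
  exact ⟨r, by rw [← cancel_mono m, Category.assoc, h1, Category.comp_id, Category.id_comp], h1⟩

/-- A morphism of conflations is an admissible monic if it is one on both ends. -/
theorem AdmMono.of_ends {X Y Z X' Y' Z' : E} {f : X ⟶ Y} {g : Y ⟶ Z} {f' : X' ⟶ Y'}
    {g' : Y' ⟶ Z'} (h : Conflation f g) (h' : Conflation f' g') {x : X ⟶ X'} {y : Y ⟶ Y'}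
    {z : Z ⟶ Z'} (hf : f ≫ y = x ≫ f') (hg : g ≫ z = y ≫ g') (hx : AdmMono x)
    (hz : AdmMono z) : AdmMono y := by
  -- `y` factors as a cobase change of `x`, an isomorphism (short five lemma), and a base change of
  -- `z`.
  obtain ⟨P, b, f₁, g₁, hP, hc₁, hb⟩ := h.exists_pushout x
  obtain ⟨R, r, f₂, g₂, hR, hc₂, hr⟩ := h'.exists_pullback z
  have hb' : AdmMono b := AdmMono.of_isPushout hP.flip hx
  have hr' : AdmMono r := AdmMono.of_isPullback hR ⟨_, _, h'⟩ hz
  have e : hP.desc y f' hf ≫ g' = g₁ ≫ z := by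
    apply hP.hom_ext
    · rw [hP.inl_desc_assoc, reassoc_of% hb, hg]
    · rw [hP.inr_desc_assoc, h'.zero, reassoc_of% hc₁.zero, zero_comp]
  have : IsIso (hR.lift (hP.desc y f' hf) g₁ e) := by
    refine hc₁.isIso_of_ends hc₂ ?_ (hR.lift_snd _ _ _)
    apply hR.hom_ext
    · rw [Category.assoc, hR.lift_fst, hP.inr_desc, hr]
    · rw [Category.assoc, hR.lift_snd, hc₁.zero, hc₂.zero]
  have hy : y = (b ≫ hR.lift (hP.desc y f' hf) g₁ e) ≫ r := by
    rw [Category.assoc, hR.lift_fst, hP.inl_desc]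
  rw [hy]
  refine AdmMono.comp (hb'.comp ?_) hr'
  generalize hR.lift (hP.desc y f' hf) g₁ e = m at this
  obtain ⟨Z₁, t, ht⟩ := AdmMono.id P
  exact ⟨Z₁, inv m ≫ t, QuillenExact.of_iso (Iso.refl _) (asIso m) (Iso.refl _) (by simp) (by simp)
    ht⟩

/-- Noether's isomorphism: the quotients of `X ⟶ Y ⟶ Y'` form a conflation. -/
theorem Conflation.quotient {X Y Y' Z Z' Q : E} {f : X ⟶ Y} {a : Y ⟶ Y'} {g : Y ⟶ Z}
    {g' : Y' ⟶ Z'} {q : Y' ⟶ Q} (h : Conflation f g) (h' : Conflation (f ≫ a) g')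
    (ha : Conflation a q) {z : Z ⟶ Z'} (hz : g ≫ z = a ≫ g') {d : Z' ⟶ Q} (hd : g' ≫ d = q) :
    Conflation z d := by
  have := h.epi
  have := h'.epi
  have := ha.epi
  have key (s : PushoutCocone a g) : ∃ m, g' ≫ m = s.inl := h'.desc s.inl (by
    rw [Category.assoc, s.condition, reassoc_of% h.zero, zero_comp])
  choose m hm using key
  -- `g` and `g'` are the cokernels of `f` and `f ≫ a`, which makes this square a pushout and `z` a
  -- cobase change of `a`.
  have hp : IsPushout a g g' z := by
    refine ⟨⟨hz.symm⟩, ⟨PushoutCocone.IsColimit.mk _ m hm (fun s => ?_) fun s t h₁ h₂ => ?_⟩⟩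
    · rw [← cancel_epi g, reassoc_of% hz, hm, s.condition]
    · rw [← cancel_epi g', h₁, hm]
  refine Conflation.of_cokernel (AdmMono.of_isPushout hp ⟨_, _, ha⟩) ?_ (epi_of_epi_fac hd)
    fun t ht => ?_
  · rw [← cancel_epi g, reassoc_of% hz, hd, ha.zero, comp_zero]
  · obtain ⟨s, hs⟩ := ha.desc (g' ≫ t) (by rw [← reassoc_of% hz, ht, comp_zero])
    exact ⟨s, by rw [← cancel_epi g', reassoc_of% hd, hs]⟩

theorem Conflation.zero_id {O : E} (hO : IsZero O) (Z : E) : Conflation (0 : O ⟶ Z) (𝟙 Z) :=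
  Conflation.of_kernel (AdmEpi.id Z) (by simp) ⟨fun _ _ _ => hO.eq_of_tgt _ _⟩
    fun t ht => ⟨0, by rw [Category.comp_id] at ht; simp [ht]⟩

theorem Conflation.id_zero {O : E} (hO : IsZero O) (Z : E) : Conflation (𝟙 Z) (0 : Z ⟶ O) :=
  Conflation.of_cokernel (AdmMono.id Z) (by simp) ⟨fun _ _ _ => hO.eq_of_src _ _⟩
    fun t ht => ⟨0, by rw [Category.id_comp] at ht; simp [ht]⟩

/-- The split conflation on two objects. -/
theorem exists_split (X Z : E) : ∃ (Y : E) (i₁ : X ⟶ Y) (i₂ : Z ⟶ Y) (p₁ : Y ⟶ X) (p₂ : Y ⟶ Z),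
    Conflation i₁ p₂ ∧ i₁ ≫ p₁ = 𝟙 X ∧ i₂ ≫ p₂ = 𝟙 Z ∧ i₂ ≫ p₁ = 0 ∧
      p₁ ≫ i₁ + p₂ ≫ i₂ = 𝟙 Y := by
  obtain ⟨Y, b, f, g, hp, hc, hb⟩ := (Conflation.zero_id (isZero_zero E) Z).exists_pushout
    (0 : _ ⟶ X)
  refine ⟨Y, f, b, hp.desc 0 (𝟙 X) (by simp), g, hc, by simp, hb, by simp, ?_⟩
  apply hp.hom_ext
  · simp [reassoc_of% hb]
  · simp [reassoc_of% hc.zero]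

end Exact

/-! ### Sections of presheaves -/

section Sections

variable {E : Type u} [Category.{v} E]

/-- The sections of a presheaf over an object. -/
def Sec (F : Eᵒᵖ ⥤ AddCommGrpCat.{v}) (A : E) : Type v := F.obj (op A)

instance (F : Eᵒᵖ ⥤ AddCommGrpCat.{v}) (A : E) : AddCommGroup (Sec F A) :=
  inferInstanceAs (AddCommGroup (F.obj (op A)))

variable {F G H T : Eᵒᵖ ⥤ AddCommGrpCat.{v}}

/-- Restriction of sections. -/
def res {A B : E} (f : B ⟶ A) : Sec F A →+ Sec F B := (F.map f.op).hom

/-- The action of a morphism of presheaves on sections. -/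
def ev (α : F ⟶ G) {A : E} : Sec F A →+ Sec G A := (α.app (op A)).hom

@[simp] theorem res_id {A : E} (x : Sec F A) : res (𝟙 A) x = x := by
  change (F.map (𝟙 (op A))).hom x = x
  rw [F.map_id]; rfl

theorem res_comp {A B B' : E} (g : B' ⟶ B) (f : B ⟶ A) (x : Sec F A) :
    res (g ≫ f) x = res g (res f x) := by
  change (F.map (f.op ≫ g.op)).hom x = _
  rw [F.map_comp]; rfl

theorem ev_res (α : F ⟶ G) {A B : E} (f : B ⟶ A) (x : Sec F A) :
    ev α (res f x) = res f (ev α x) :=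
  congrArg (fun t => t.hom x) (α.naturality f.op)

@[simp] theorem ev_id {A : E} (x : Sec F A) : ev (𝟙 F) x = x := rfl

theorem ev_comp (α : F ⟶ G) (β : G ⟶ H) {A : E} (x : Sec F A) :
    ev (α ≫ β) x = ev β (ev α x) := rfl

@[simp] theorem ev_zero {A : E} (x : Sec F A) : ev (0 : F ⟶ G) x = 0 := rfl

theorem hom_ext_ev {α β : F ⟶ G} (h : ∀ (A : E) (x : Sec F A), ev α x = ev β x) : α = β := by
  ext A x
  exact h A.unop x

/-- A morphism of presheaves is given by a total additive functional relation. -/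
theorem exists_hom_of_rel (R : ∀ A : E, Sec F A → Sec G A → Prop)
    (ex : ∀ (A : E) (x : Sec F A), ∃ y, R A x y)
    (uniq : ∀ (A : E) (x : Sec F A) (y y' : Sec G A), R A x y → R A x y' → y = y')
    (add : ∀ (A : E) (x x' : Sec F A) (y y' : Sec G A), R A x y → R A x' y' →
      R A (x + x') (y + y'))
    (nat : ∀ (A B : E) (f : B ⟶ A) (x : Sec F A) (y : Sec G A), R A x y →
      R B (res f x) (res f y)) :
    ∃ α : F ⟶ G, ∀ (A : E) (x : Sec F A) (y : Sec G A), R A x y → ev α x = y := by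
  choose φ hφ using ex
  refine ⟨{ app := fun A => AddCommGrpCat.ofHom (AddMonoidHom.mk' (φ A.unop) fun x y =>
              uniq _ _ _ _ (hφ _ _) (add _ _ _ _ _ (hφ _ x) (hφ _ y)))
            naturality := fun A B f => ?_ }, fun A x y h => uniq _ _ _ _ (hφ _ _) h⟩
  ext x
  exact uniq B.unop _ _ _ (hφ _ _) (nat A.unop B.unop f.unop x _ (hφ _ _))

theorem isIso_of_bijective (α : F ⟶ G) (hi : ∀ A : E, Function.Injective (ev α (A := A)))
    (hs : ∀ A : E, Function.Surjective (ev α (A := A))) : IsIso α := by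
  obtain ⟨β, hβ⟩ := exists_hom_of_rel (F := G) (G := F) (fun A y x => ev α x = y)
    (fun A y => hs A y) (fun A y x x' h h' => hi A (h.trans h'.symm))
    (fun A y y' x x' h h' => by rw [map_add, h, h'])
    (fun A B f y x h => by rw [ev_res, h])
  exact ⟨β, hom_ext_ev fun A x => hβ A _ _ rfl, hom_ext_ev fun A y => by
    obtain ⟨x, rfl⟩ := hs A y
    exact congrArg (ev α) (hβ A _ x rfl)⟩

theorem bijective_of_isIso (α : F ⟶ G) [IsIso α] (A : E) :
    Function.Bijective (ev α (A := A)) := by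
  refine Function.bijective_iff_has_inverse.2 ⟨ev (inv α), fun x => ?_, fun x => ?_⟩
  · rw [← ev_comp, IsIso.hom_inv_id, ev_id]
  · rw [← ev_comp, IsIso.inv_hom_id, ev_id]

/-- A morphism with values in the image of a monic factors through it. -/
theorem exists_lift_of_mem_range {α : F ⟶ G} (hα : ∀ A : E, Function.Injective (ev α (A := A)))
    (μ : T ⟶ G) (h : ∀ (A : E) (x : Sec T A), ∃ y : Sec F A, ev α y = ev μ x) :
    ∃ l : T ⟶ F, l ≫ α = μ := by
  obtain ⟨l, hl⟩ := exists_hom_of_rel (F := T) (G := F) (fun A x y => ev α y = ev μ x) h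
    (fun A x y y' h h' => hα A (h.trans h'.symm))
    (fun A x x' y y' h h' => by rw [map_add, map_add, h, h'])
    (fun A B f x y h => by rw [ev_res, ev_res, h])
  refine ⟨l, hom_ext_ev fun A x => ?_⟩
  obtain ⟨y, hy⟩ := h A x
  rw [ev_comp, hl A x y hy, hy]

/-- The subpresheaf given by a family of subgroups stable under restriction. -/
def subPsh (S : ∀ A : E, AddSubgroup (Sec G A))
    (hS : ∀ {A B : E} (f : B ⟶ A) (x : Sec G A), x ∈ S A → res f x ∈ S B) :
    Eᵒᵖ ⥤ AddCommGrpCat.{v} where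
  obj A := AddCommGrpCat.of (S A.unop)
  map {A B} f := AddCommGrpCat.ofHom
    (((res f.unop).comp (S A.unop).subtype).codRestrict (S B.unop) fun x => hS _ _ x.2)
  map_id A := by
    ext x
    exact res_id (A := A.unop) x.1
  map_comp {A B B'} f g := by
    ext x
    exact res_comp g.unop f.unop x.1

/-- The inclusion of a subpresheaf. -/
def subPshι (S : ∀ A : E, AddSubgroup (Sec G A))
    (hS : ∀ {A B : E} (f : B ⟶ A) (x : Sec G A), x ∈ S A → res f x ∈ S B) :
    subPsh S hS ⟶ G where
  app A := AddCommGrpCat.ofHom (S A.unop).subtype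

section subPsh

variable {S : ∀ A : E, AddSubgroup (Sec G A)}
  {hS : ∀ {A B : E} (f : B ⟶ A) (x : Sec G A), x ∈ S A → res f x ∈ S B}

theorem subPshι_injective (A : E) : Function.Injective (ev (subPshι S hS) (A := A)) :=
  Subtype.val_injective

theorem subPshι_mem {A : E} (x : Sec (subPsh S hS) A) : ev (subPshι S hS) x ∈ S A := x.2

theorem exists_subPshι {A : E} {x : Sec G A} (hx : x ∈ S A) :
    ∃ y : Sec (subPsh S hS) A, ev (subPshι S hS) y = x := ⟨(⟨x, hx⟩ : S A), rfl⟩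

end subPsh

variable (F G)

/-- The product of two presheaves. -/
def prodPsh : Eᵒᵖ ⥤ AddCommGrpCat.{v} where
  obj A := AddCommGrpCat.of (Sec F A.unop × Sec G A.unop)
  map {A B} f := AddCommGrpCat.ofHom ((res f.unop).prodMap (res f.unop))
  map_id A := by
    ext x
    · exact res_id (A := A.unop) x.1
    · exact res_id (A := A.unop) x.2
  map_comp {A B B'} f g := by
    ext x
    · exact res_comp g.unop f.unop x.1
    · exact res_comp g.unop f.unop x.2

/-- The first projection. -/
def prodPsh.fst : prodPsh F G ⟶ F where
  app A := AddCommGrpCat.ofHom (AddMonoidHom.fst (Sec F A.unop) (Sec G A.unop))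

/-- The second projection. -/
def prodPsh.snd : prodPsh F G ⟶ G where
  app A := AddCommGrpCat.ofHom (AddMonoidHom.snd (Sec F A.unop) (Sec G A.unop))

variable {F G}

theorem prodPsh_ext {A : E} {x y : Sec (prodPsh F G) A}
    (h₁ : ev (prodPsh.fst F G) x = ev (prodPsh.fst F G) y)
    (h₂ : ev (prodPsh.snd F G) x = ev (prodPsh.snd F G) y) : x = y := Prod.ext h₁ h₂

theorem exists_prodPsh {A : E} (x : Sec F A) (y : Sec G A) : ∃ z : Sec (prodPsh F G) A,
    ev (prodPsh.fst F G) z = x ∧ ev (prodPsh.snd F G) z = y := ⟨(x, y), rfl, rfl⟩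

variable [Preadditive E]

/-- The presheaf represented by an object. -/
abbrev yo (Y : E) : Eᵒᵖ ⥤ AddCommGrpCat.{v} := preadditiveYoneda.obj Y

/-- The action of a morphism out of a representable presheaf on sections. -/
def ap {Y : E} (ι : yo Y ⟶ F) {A : E} : (A ⟶ Y) →+ Sec F A := (ι.app (op A)).hom

variable {X Y : E}

theorem res_ap (ι : yo Y ⟶ F) {A B : E} (g : B ⟶ A) (f : A ⟶ Y) :
    res g (ap ι f) = ap ι (g ≫ f) :=
  (congrArg (fun t => t.hom f) (ι.naturality g.op)).symm

theorem ap_comp (ι : yo Y ⟶ F) (α : F ⟶ G) {A : E} (f : A ⟶ Y) :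
    ap (ι ≫ α) f = ev α (ap ι f) := rfl

theorem ap_map (a : X ⟶ Y) (ι : yo Y ⟶ F) {A : E} (f : A ⟶ X) :
    ap (preadditiveYoneda.map a ≫ ι) f = ap ι (f ≫ a) := rfl

theorem ap_eq_res (ι : yo Y ⟶ F) {A : E} (f : A ⟶ Y) : ap ι f = res f (ap ι (𝟙 Y)) := by
  rw [res_ap, Category.comp_id]

theorem hom_ext_ap {ι κ : yo Y ⟶ F} (h : ap ι (𝟙 Y) = ap κ (𝟙 Y)) : ι = κ := by
  have (A : E) (f : A ⟶ Y) : ap ι f = ap κ f := by rw [ap_eq_res, h, ← ap_eq_res]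
  exact hom_ext_ev this

theorem yo_map_eq_iff {a b : X ⟶ Y} :
    preadditiveYoneda.map a = preadditiveYoneda.map b ↔ a = b :=
  preadditiveYoneda.map_injective.eq_iff

theorem exists_yo_map (α : yo X ⟶ yo Y) : ∃ a : X ⟶ Y, preadditiveYoneda.map a = α :=
  preadditiveYoneda.map_surjective α

theorem exists_yo_map_comp {ι : yo Y ⟶ F} (μ : yo X ⟶ F) (h : ∃ a : X ⟶ Y, ap ι a = ap μ (𝟙 X)) :
    ∃ a : X ⟶ Y, preadditiveYoneda.map a ≫ ι = μ := by
  obtain ⟨a, ha⟩ := h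
  exact ⟨a, hom_ext_ap (by rw [ap_map, Category.id_comp, ha])⟩

end Sections

/-! ### Left exact presheaves -/

section LeftExact

variable {E : Type u} [Category.{v} E] [Preadditive E] [HasConflations E] [QuillenExact E]
  {F G H T : Eᵒᵖ ⥤ AddCommGrpCat.{v}}

namespace isLeftExact

theorem eq_of_res (hF : isLeftExact E F) {A B : E} {p : B ⟶ A} (hp : AdmEpi p) {x y : Sec F A}
    (h : res p x = res p y) : x = y := by
  obtain ⟨K, k, hk⟩ := hp
  exact (hF k p hk).1 h

theorem exists_of_res (hF : isLeftExact E F) {A B K : E} {k : K ⟶ B} {p : B ⟶ A}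
    (hp : Conflation k p) {x : Sec F B} (h : res k x = 0) : ∃ y : Sec F A, res p y = x :=
  ((hF k p hp).2 x).1 h

theorem res_of_isZero (hF : isLeftExact E F) {O : E} (hO : IsZero O) (x : Sec F O) : x = 0 := by
  have h := (hF _ _ (Conflation.zero_id hO O)).2
  have h2 : (0 : O ⟶ O) = 𝟙 O := hO.eq_of_src _ _
  rw [h2] at h
  have := (h x).2 ⟨x, res_id x⟩
  exact (res_id x).symm.trans this

theorem res_zero (hF : isLeftExact E F) {A B : E} (x : Sec F A) : res (0 : B ⟶ A) x = 0 := by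
  have : (0 : B ⟶ A) = (0 : B ⟶ (0 : E)) ≫ (0 : (0 : E) ⟶ A) := by simp
  rw [this, res_comp, hF.res_of_isZero (isZero_zero E) (res _ x), map_zero]

/-- Presheaves are not assumed additive as functors; left exactness on a split conflation forces it.
The case of the two projections is universal: restricting along the map with components `f` and `g`
gives the rest. -/
theorem res_add (hF : isLeftExact E F) {A B : E} (f g : B ⟶ A) (x : Sec F A) :
    res (f + g) x = res f x + res g x := by
  obtain ⟨S, i₁, i₂, p₁, p₂, hc, h11, h22, h21, hs⟩ := exists_split A A
  have key : res (p₁ + p₂) x = res p₁ x + res p₂ x := by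
    obtain ⟨t, ht⟩ := hF.exists_of_res hc (x := res (p₁ + p₂) x - res p₁ x - res p₂ x) (by
      simp only [map_sub, ← res_comp, Preadditive.comp_add, h11, hc.zero, add_zero, res_id,
        sub_self, hF.res_zero])
    have h0 : t = 0 := by
      have := congrArg (res i₂) ht
      rw [← res_comp, h22, res_id] at this
      rw [this]
      simp only [map_sub, ← res_comp, Preadditive.comp_add, h22, h21, zero_add, hF.res_zero,
        sub_self, sub_zero, res_id]
    rw [h0, map_zero] at ht
    rw [← sub_eq_zero, ← sub_sub, ← ht]
  have e₁ : (f ≫ i₁ + g ≫ i₂) ≫ p₁ = f := by simp [h11, h21]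
  have e₂ : (f ≫ i₁ + g ≫ i₂) ≫ p₂ = g := by simp [hc.zero, h22]
  have := congrArg (res (f ≫ i₁ + g ≫ i₂)) key
  rwa [map_add, ← res_comp, ← res_comp, ← res_comp, Preadditive.comp_add, e₁, e₂] at this

/-- The Yoneda lemma for left exact presheaves. -/
theorem exists_ap (hF : isLeftExact E F) {Y : E} (x : Sec F Y) :
    ∃ ι : yo Y ⟶ F, ∀ (A : E) (f : A ⟶ Y), ap ι f = res f x := by
  refine ⟨{ app := fun A => AddCommGrpCat.ofHom (AddMonoidHom.mk'
              (fun f : A.unop ⟶ Y => (res f x : Sec F A.unop)) fun f g => hF.res_add f g x)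
            naturality := fun A B g => ?_ }, fun A f => rfl⟩
  ext f
  exact res_comp g.unop f x

end isLeftExact

theorem isLeftExact_prodPsh (hF : isLeftExact E F) (hG : isLeftExact E G) :
    isLeftExact E (prodPsh F G) := by
  intro X Y Z f g h
  refine ⟨fun a b hab => ?_, fun y => ⟨fun hy => ?_, ?_⟩⟩
  · exact prodPsh_ext ((hF f g h).1 (congrArg Prod.fst hab)) ((hG f g h).1 (congrArg Prod.snd hab))
  · obtain ⟨a, ha⟩ := ((hF f g h).2 y.1).1 (congrArg Prod.fst hy)
    obtain ⟨b, hb⟩ := ((hG f g h).2 y.2).1 (congrArg Prod.snd hy)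
    exact ⟨(a, b), Prod.ext ha hb⟩
  · rintro ⟨z, rfl⟩
    exact Prod.ext (((hF f g h).2 _).2 ⟨z.1, rfl⟩) (((hG f g h).2 _).2 ⟨z.2, rfl⟩)

/-- A subpresheaf that satisfies descent along admissible epics is left exact. -/
theorem isLeftExact_subPsh (hG : isLeftExact E G) {S : ∀ A : E, AddSubgroup (Sec G A)}
    {hS : ∀ {A B : E} (f : B ⟶ A) (x : Sec G A), x ∈ S A → res f x ∈ S B}
    (hd : ∀ {A B : E} (p : B ⟶ A) (x : Sec G A), AdmEpi p → res p x ∈ S B → x ∈ S A) :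
    isLeftExact E (subPsh S hS) := by
  intro X Y Z f g h
  refine ⟨fun a b hab => ?_, fun y => ⟨fun hy => ?_, ?_⟩⟩
  · exact Subtype.ext ((hG f g h).1 (congrArg Subtype.val hab))
  · obtain ⟨a, ha⟩ := ((hG f g h).2 y.1).1 (congrArg Subtype.val hy)
    exact ⟨⟨a, hd g a ⟨_, _, h⟩ (by exact ha ▸ y.2)⟩, Subtype.ext ha⟩
  · rintro ⟨z, rfl⟩
    exact Subtype.ext (((hG f g h).2 _).2 ⟨z.1, rfl⟩)

/-- Sections lift locally, that is, after restriction along an admissible epic. -/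
def LocSurj (β : G ⟶ H) : Prop :=
  ∀ (A : E) (h : Sec H A), ∃ (B : E) (p : B ⟶ A) (g : Sec G B), AdmEpi p ∧ ev β g = res p h

/-- Morphisms out of the target of a locally surjective morphism. -/
theorem LocSurj.exists_desc {N U : Eᵒᵖ ⥤ AddCommGrpCat.{v}} {π : N ⟶ U} (hπ : LocSurj π)
    (hU : isLeftExact E U) (hT : isLeftExact E T) (φ : N ⟶ T)
    (h : ∀ (A : E) (n : Sec N A), ev π n = 0 → ev φ n = 0) : ∃ ψ : U ⟶ T, π ≫ ψ = φ := by
  have h' {A : E} {m n : Sec N A} (hmn : ev π m = ev π n) : ev φ m = ev φ n := by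
    rw [← sub_eq_zero, ← map_sub]
    exact h _ _ (by rw [map_sub, hmn, sub_self])
  -- The value at `u` is the section that agrees with `φ n` for every lift `n` of every restriction
  -- of `u`. Quantifying over all `q`, not only admissible epics, makes naturality immediate;
  -- existence and uniqueness come from one covering.
  suffices hψ : ∃ ψ : U ⟶ T, ∀ (A : E) (u : Sec U A) (t : Sec T A),
      (∀ (B : E) (q : B ⟶ A) (n : Sec N B), ev π n = res q u → ev φ n = res q t) →
        ev ψ u = t by
    obtain ⟨ψ, hψ⟩ := hψ
    refine ⟨ψ, hom_ext_ev fun A n => hψ A (ev π n) _ fun B q m hm => ?_⟩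
    rw [← ev_res] at hm ⊢
    exact h' hm
  refine exists_hom_of_rel _ (fun A u => ?_) (fun A u t t' ht ht' => ?_)
    (fun A u u' t t' ht ht' B q n hn => ?_)
    (fun A A' f u t ht B q n hn => by rw [← res_comp] at hn ⊢; exact ht B _ n hn)
  · obtain ⟨B, p, m, ⟨K, k, hk⟩, hm⟩ := hπ A u
    obtain ⟨t, ht⟩ := hT.exists_of_res hk (x := ev φ m) (by
      rw [← ev_res]
      exact h _ _ (by rw [ev_res, hm, ← res_comp, hk.zero, hU.res_zero]))
    refine ⟨t, fun B' q n hn => ?_⟩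
    obtain ⟨B'', r, s, hr, hs⟩ := AdmEpi.exists_lift ⟨K, k, hk⟩ q
    refine hT.eq_of_res hr ?_
    rw [← res_comp, ← hs, res_comp, ht, ← ev_res, ← ev_res]
    refine h' ?_
    rw [ev_res, ev_res, hn, hm, ← res_comp, ← res_comp, hs]
  · obtain ⟨B, p, m, hp, hm⟩ := hπ A u
    exact hT.eq_of_res hp ((ht B p m hm).symm.trans (ht' B p m hm))
  · obtain ⟨B₁, p₁, m₁, hp₁, hm₁⟩ := hπ B (res q u)
    obtain ⟨B₂, p₂, m₂, hp₂, hm₂⟩ := hπ B₁ (res p₁ (res q u'))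
    have e₁ := ht B₁ (p₁ ≫ q) m₁ (by rw [hm₁, res_comp])
    have e₂ := ht' B₂ (p₂ ≫ p₁ ≫ q) m₂ (by rw [hm₂, res_comp, res_comp])
    refine hT.eq_of_res (hp₂.comp hp₁) ?_
    rw [map_add, map_add, ← res_comp _ q t', Category.assoc, ← e₂, res_comp p₂ p₁ (res q t),
      ← res_comp _ q t, ← e₁, ← ev_res, ← ev_res, ← map_add]
    refine h' ?_
    rw [ev_res, hn, map_add, map_add, map_add, hm₂, ev_res, hm₁, res_comp p₂ p₁, res_comp p₂ p₁]

theorem LocSurj.hom_ext {π : G ⟶ H} (hπ : LocSurj π) (hT : isLeftExact E T) {φ ψ : H ⟶ T}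
    (h : π ≫ φ = π ≫ ψ) : φ = ψ := by
  refine hom_ext_ev fun A x => ?_
  obtain ⟨B, p, g, hp, hg⟩ := hπ A x
  refine hT.eq_of_res hp ?_
  rw [← ev_res, ← ev_res, ← hg, ← ev_comp, ← ev_comp, h]

/-- The sections that lie locally in the image of a monic of left exact presheaves lie in it. -/
theorem exists_of_locally {α : F ⟶ G} (hF : isLeftExact E F) (hG : isLeftExact E G)
    (hα : ∀ A : E, Function.Injective (ev α (A := A))) {A B : E} {p : B ⟶ A} (hp : AdmEpi p)
    {x : Sec G A} (h : ∃ y : Sec F B, ev α y = res p x) : ∃ y : Sec F A, ev α y = x := by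
  obtain ⟨y, hy⟩ := h
  have hp' := hp
  obtain ⟨K, k, hk⟩ := hp'
  obtain ⟨z, hz⟩ := hF.exists_of_res hk (x := y) (hα _ (by
    rw [ev_res, hy, ← res_comp, hk.zero, hG.res_zero, map_zero]))
  exact ⟨z, hG.eq_of_res hp (by rw [← ev_res, hz, hy])⟩

/-- Short exact sequences of left exact presheaves, in terms of sections. -/
structure LexExact (α : F ⟶ G) (β : G ⟶ H) : Prop where
  injective : ∀ A : E, Function.Injective (ev α (A := A))
  zero : ∀ {A : E} (x : Sec F A), ev β (ev α x) = 0
  exact : ∀ {A : E} (y : Sec G A), ev β y = 0 → ∃ x : Sec F A, ev α x = y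
  locSurj : LocSurj β

theorem LexExact.of_conflation {X Y Z : E} {f : X ⟶ Y} {g : Y ⟶ Z} (h : Conflation f g) :
    LexExact (preadditiveYoneda.map f) (preadditiveYoneda.map g) where
  injective A s t hst := by
    have := h.mono
    exact (cancel_mono f).1 hst
  zero x := by
    exact (Category.assoc (obj := E) x f g).trans ((congrArg (fun t => x ≫ t) h.zero).trans
      comp_zero)
  exact y hy := h.lift _ hy
  locSurj A z := by
    obtain ⟨B, q, t, hq, ht⟩ := AdmEpi.exists_lift ⟨X, f, h⟩ (A := A) z
    exact ⟨B, q, t, hq, ht⟩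

theorem isKernelCokernelPair_of_lexExact {F G H : Lex E} {α : F ⟶ G} {β : G ⟶ H}
    (h : LexExact α.hom β.hom) : IsKernelCokernelPair α β := by
  have w : α ≫ β = 0 := ObjectProperty.hom_ext _ (hom_ext_ev fun A x => h.zero x)
  have hl {K : Lex E} (t : K ⟶ G) (ht : t ≫ β = 0) : ∃ s : K ⟶ F, s ≫ α = t := by
    obtain ⟨l, hl⟩ := exists_lift_of_mem_range h.injective t.hom fun A x => h.exact _
      (congrArg (fun r => ev r.hom x) ht)
    exact ⟨ObjectProperty.homMk l, ObjectProperty.hom_ext _ hl⟩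
  have hd {K : Lex E} (t : G ⟶ K) (ht : α ≫ t = 0) : ∃ s : H ⟶ K, β ≫ s = t := by
    obtain ⟨l, hl⟩ := h.locSurj.exists_desc H.property K.property t.hom fun A y hy => by
      obtain ⟨x, rfl⟩ := h.exact y hy
      exact congrArg (fun r => ev r.hom x) ht
    exact ⟨ObjectProperty.homMk l, ObjectProperty.hom_ext _ hl⟩
  refine ⟨w, ⟨KernelFork.IsLimit.ofι _ _ (fun t ht => (hl t ht).choose)
    (fun t ht => (hl t ht).choose_spec) fun t ht m hm => ?_⟩,
    ⟨CokernelCofork.IsColimit.ofπ _ _ (fun t ht => (hd t ht).choose)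
    (fun t ht => (hd t ht).choose_spec) fun t ht m hm => ?_⟩⟩
  · have := hm.trans (hl t ht).choose_spec.symm
    refine ObjectProperty.hom_ext _ (hom_ext_ev fun A x => h.injective A ?_)
    exact congrArg (fun r => ev r.hom x) this
  · rename_i K
    have := hm.trans (hd t ht).choose_spec.symm
    exact ObjectProperty.hom_ext _ (h.locSurj.hom_ext K.property
      (congrArg (fun r => r.hom) this))

/-- Representables are left exact, so they detect the kernel on sections. For local surjectivity,
the sections of `H` that lift locally form a left exact subpresheaf through which `β` factors; the
universal property of the cokernel then splits its inclusion into `H`, so it is everything. -/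
theorem lexExact_of_isKernelCokernelPair {F G H : Lex E} {α : F ⟶ G} {β : G ⟶ H}
    (h : IsKernelCokernelPair α β) : LexExact α.hom β.hom := by
  obtain ⟨w, ⟨hα⟩, ⟨hβ⟩⟩ := h
  have hw {A : E} (x : Sec F.obj A) : ev β.hom (ev α.hom x) = 0 :=
    congrArg (fun r => ev r.hom x) w
  refine ⟨fun A x y hxy => ?_, hw, fun {A} y hy => ?_, ?_⟩
  · obtain ⟨ι, hι⟩ := F.property.exists_ap x
    obtain ⟨κ, hκ⟩ := F.property.exists_ap y
    have : (ObjectProperty.homMk ι : (toLex E).obj A ⟶ F) = ObjectProperty.homMk κ := by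
      refine Fork.IsLimit.hom_ext hα (ObjectProperty.hom_ext _ (hom_ext_ap ?_))
      change ap (ι ≫ α.hom) (𝟙 A) = ap (κ ≫ α.hom) (𝟙 A)
      rw [ap_comp, ap_comp, hι, hκ, res_id, res_id, hxy]
    rw [← res_id x, ← res_id y, ← hι, ← hκ]
    exact congrArg (fun r : (toLex E).obj A ⟶ F => ap r.hom (𝟙 A)) this
  · obtain ⟨ι, hι⟩ := G.property.exists_ap y
    obtain ⟨l, hl⟩ := KernelFork.IsLimit.lift' hα
      (ObjectProperty.homMk ι : (toLex E).obj A ⟶ G) (ObjectProperty.hom_ext _ (hom_ext_ap (by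
        change ap (ι ≫ β.hom) (𝟙 A) = 0
        rw [ap_comp, hι, res_id, hy])))
    refine ⟨ap (F := F.obj) l.hom (𝟙 A), ?_⟩
    rw [← res_id y, ← hι]
    exact congrArg (fun r : (toLex E).obj A ⟶ G => ap r.hom (𝟙 A)) hl
  · let S (A : E) : AddSubgroup (Sec H.obj A) :=
      { carrier := { z | ∃ (B : E) (p : B ⟶ A) (g : Sec G.obj B), AdmEpi p ∧
          ev β.hom g = res p z }
        zero_mem' := ⟨A, 𝟙 A, 0, AdmEpi.id A, by simp⟩
        neg_mem' := by
          rintro z ⟨B, p, g, hp, hg⟩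
          exact ⟨B, p, -g, hp, by rw [map_neg, map_neg, hg]⟩
        add_mem' := by
          rintro z z' ⟨B, p, g, hp, hg⟩ ⟨B', p', g', hp', hg'⟩
          obtain ⟨R, r, s, hr, hs⟩ := hp'.exists_lift p
          exact ⟨R, r ≫ p, res r g + res s g', hr.comp hp, by
            rw [map_add, map_add, ev_res, ev_res, hg, hg', ← res_comp, ← res_comp, hs]⟩ }
    have hS {A B : E} (f : B ⟶ A) (z : Sec H.obj A) (hz : z ∈ S A) : res f z ∈ S B := by
      obtain ⟨R, p, g, hp, hg⟩ := hz
      obtain ⟨R', r, s, hr, hs⟩ := hp.exists_lift f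
      exact ⟨R', r, res s g, hr, by rw [ev_res, hg, ← res_comp, ← res_comp, hs]⟩
    let Q : Lex E := ⟨subPsh S hS, isLeftExact_subPsh H.property fun p x hp hx => by
      obtain ⟨R, r, g, hr, hg⟩ := hx
      exact ⟨R, r ≫ p, g, hr.comp hp, by rw [hg, res_comp]⟩⟩
    let j : Q ⟶ H := ObjectProperty.homMk (subPshι S hS)
    obtain ⟨l, hl⟩ := exists_lift_of_mem_range (subPshι_injective (S := S) (hS := hS)) β.hom
      fun A g => exists_subPshι ⟨A, 𝟙 A, g, AdmEpi.id A, by simp⟩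
    obtain ⟨d, hd⟩ := CokernelCofork.IsColimit.desc' hβ (ObjectProperty.homMk l : G ⟶ Q)
      (ObjectProperty.hom_ext _ (hom_ext_ev fun A x => subPshι_injective A (by
        change ev (subPshι S hS) (ev l (ev α.hom x)) = ev (subPshι S hS) 0
        rw [← ev_comp l, hl, hw, map_zero])))
    have hj : d ≫ j = 𝟙 H := by
      refine Cofork.IsColimit.hom_ext hβ ?_
      change β ≫ d ≫ j = β ≫ 𝟙 H
      rw [← Category.assoc, show β ≫ d = _ from hd, Category.comp_id]
      exact ObjectProperty.hom_ext _ hl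
    intro A z
    have : ev (subPshι S hS) (ev d.hom z) = z := congrArg (fun r => ev r.hom z) hj
    have hz := subPshι_mem (S := S) (hS := hS) (ev d.hom z)
    rwa [this] at hz

theorem conflation_lex_iff {F G H : Lex E} {α : F ⟶ G} {β : G ⟶ H} :
    Conflation α β ↔ LexExact α.hom β.hom :=
  ⟨lexExact_of_isKernelCokernelPair, isKernelCokernelPair_of_lexExact⟩

end LeftExact

/-! ### Directed unions of representable presheaves -/

section Union

variable {E : Type u} [Category.{v} E] [Preadditive E] {I : Type w} [Preorder I]
  {F T : Eᵒᵖ ⥤ AddCommGrpCat.{v}}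

/-- `F` is the directed union of the representable presheaves of the objects of a diagram. -/
structure IsUnion (X : I ⥤ E) (ι : ∀ i, yo (X.obj i) ⟶ F) : Prop where
  comp : ∀ {i j : I} (h : i ⟶ j), preadditiveYoneda.map (X.map h) ≫ ι j = ι i
  injective : ∀ (i : I) (A : E), Function.Injective (ap (ι i) (A := A))
  exists_ap : ∀ (A : E) (x : Sec F A), ∃ (i : I) (f : A ⟶ X.obj i), ap (ι i) f = x

namespace IsUnion

variable {X : I ⥤ E} {ι : ∀ i, yo (X.obj i) ⟶ F}

theorem ap_map (h : IsUnion X ι) {i j : I} (a : i ⟶ j) {A : E} (f : A ⟶ X.obj i) :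
    ap (ι j) (f ≫ X.map a) = ap (ι i) f := by
  rw [← h.comp a]; rfl

theorem exists_desc [IsDirectedOrder I] (h : IsUnion X ι) (t : ∀ i, yo (X.obj i) ⟶ T)
    (ht : ∀ {i j : I} (a : i ⟶ j), preadditiveYoneda.map (X.map a) ≫ t j = t i) :
    ∃ φ : F ⟶ T, ∀ i, ι i ≫ φ = t i := by
  have ht' {i j : I} (a : i ⟶ j) {A : E} (f : A ⟶ X.obj i) :
      ap (t j) (f ≫ X.map a) = ap (t i) f := by
    rw [← ht a]; rfl
  suffices key : ∃ φ : F ⟶ T, ∀ (A : E) (x : Sec F A) (y : Sec T A),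
      (∃ (i : I) (f : A ⟶ X.obj i), ap (ι i) f = x ∧ ap (t i) f = y) → ev φ x = y by
    obtain ⟨φ, hφ⟩ := key
    exact ⟨φ, fun i => hom_ext_ap (hφ _ _ _ ⟨i, 𝟙 _, rfl, rfl⟩)⟩
  refine exists_hom_of_rel _ (fun A x => ?_) ?_ ?_ ?_
  · obtain ⟨i, f, hf⟩ := h.exists_ap A x
    exact ⟨_, i, f, hf, rfl⟩
  · rintro A x y y' ⟨i, f, rfl, rfl⟩ ⟨j, g, hg, rfl⟩
    obtain ⟨k, hi, hj⟩ := exists_ge_ge i j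
    rw [← ht' (homOfLE hi), ← ht' (homOfLE hj)]
    congr 1
    apply h.injective k
    rw [h.ap_map, h.ap_map, hg]
  · rintro A x x' y y' ⟨i, f, rfl, rfl⟩ ⟨j, g, rfl, rfl⟩
    obtain ⟨k, hi, hj⟩ := exists_ge_ge i j
    refine ⟨k, f ≫ X.map (homOfLE hi) + g ≫ X.map (homOfLE hj), ?_, ?_⟩
    · rw [map_add, h.ap_map, h.ap_map]
    · rw [map_add, ht', ht']
  · rintro A B g x y ⟨i, f, rfl, rfl⟩
    exact ⟨i, g ≫ f, (res_ap _ _ _).symm, (res_ap _ _ _).symm⟩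

theorem hom_ext (h : IsUnion X ι) {φ ψ : F ⟶ T} (hφ : ∀ i, ι i ≫ φ = ι i ≫ ψ) : φ = ψ := by
  refine hom_ext_ev fun A x => ?_
  obtain ⟨i, f, rfl⟩ := h.exists_ap A x
  rw [← ap_comp, hφ, ap_comp]

theorem isColimitOf [IsDirectedOrder I] (h : IsUnion X ι) : IsColimitOf X F := by
  refine ⟨{ app := ι, naturality := fun i j a => (h.comp a).trans (Category.comp_id _).symm }, ⟨?_⟩⟩
  have key (s : Cocone (X ⋙ preadditiveYoneda)) := h.exists_desc s.ι.app fun a => s.w a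
  exact
    { desc := fun s => (key s).choose
      fac := fun s => (key s).choose_spec
      uniq := fun s m hm => h.hom_ext fun i => (hm i).trans ((key s).choose_spec i).symm }

/-- Colimits of presheaves are computed sectionwise, and directed ones on underlying sets; monic
transition maps turn eventual equality of sections into equality. -/
theorem of_isColimitOf [IsDirectedOrder I] [Nonempty I] [HasColimitsOfShape I AddCommGrpCat.{v}]
    [PreservesColimitsOfShape I (forget AddCommGrpCat.{v})] (hX : ∀ {i j : I} (a : i ⟶ j),
      Mono (X.map a)) (h : IsColimitOf X F) : ∃ ι : ∀ i, yo (X.obj i) ⟶ F, IsUnion X ι := by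
  obtain ⟨c, ⟨hc⟩⟩ := h
  have hA (A : E) := isColimitOfPreserves ((evaluation _ _).obj (op A)) hc
  refine ⟨c.app, fun a => (c.naturality a).trans (Category.comp_id _), fun i A f g hfg => ?_,
    fun A x => ?_⟩
  · obtain ⟨j, a, b, hab⟩ := Concrete.isColimit_exists_of_rep_eq _ (hA A) f g hfg
    obtain rfl : a = b := Subsingleton.elim _ _
    have := hX a
    exact (cancel_mono (X.map a)).1 hab
  · exact Concrete.isColimit_exists_rep _ (hA A) x

theorem exists_isUnion (X : I ⥤ E) [IsDirectedOrder I] [Nonempty I]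
    [HasColimitsOfShape I AddCommGrpCat.{v}]
    [PreservesColimitsOfShape I (forget AddCommGrpCat.{v})] (hX : ∀ {i j : I} (a : i ⟶ j),
      Mono (X.map a)) : ∃ (F : Eᵒᵖ ⥤ AddCommGrpCat.{v}) (ι : ∀ i, yo (X.obj i) ⟶ F),
      IsUnion X ι :=
  ⟨colimit (X ⋙ preadditiveYoneda), of_isColimitOf hX
    ⟨(colimit.cocone (X ⋙ preadditiveYoneda)).ι, ⟨colimit.isColimit _⟩⟩⟩

theorem restrict {J : Type*} [Preorder J] (h : IsUnion X ι) (φ : J ⥤ I)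
    (hφ : ∀ i, ∃ j, i ≤ φ.obj j) : IsUnion (φ ⋙ X) (fun j => ι (φ.obj j)) where
  comp a := h.comp (φ.map a)
  injective j := h.injective (φ.obj j)
  exists_ap A x := by
    obtain ⟨i, f, rfl⟩ := h.exists_ap A x
    obtain ⟨j, hj⟩ := hφ i
    exact ⟨j, f ≫ X.map (homOfLE hj), h.ap_map _ _⟩

section Cofinal

variable {J : Type*} [Preorder J] {φ : J → I}

theorem exists_ap_cofinal (h : IsUnion X ι) (hc : ∀ i, ∃ j, i ≤ φ j) (A : E) (x : Sec F A) :
    ∃ (j : J) (f : A ⟶ X.obj (φ j)), ap (ι (φ j)) f = x := by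
  obtain ⟨i, f, rfl⟩ := h.exists_ap A x
  obtain ⟨j, hj⟩ := hc i
  exact ⟨j, f ≫ X.map (homOfLE hj), h.ap_map _ _⟩

theorem hom_ext_cofinal (h : IsUnion X ι) (hc : ∀ i, ∃ j, i ≤ φ j) {s t : F ⟶ T}
    (hst : ∀ j, ι (φ j) ≫ s = ι (φ j) ≫ t) : s = t := by
  refine hom_ext_ev fun A x => ?_
  obtain ⟨j, f, rfl⟩ := h.exists_ap_cofinal hc A x
  rw [← ap_comp, hst, ap_comp]

theorem exists_desc_cofinal [IsDirectedOrder J] (h : IsUnion X ι) (hφ : Monotone φ)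
    (hc : ∀ i, ∃ j, i ≤ φ j) (t : ∀ j, yo (X.obj (φ j)) ⟶ T)
    (ht : ∀ {i j : J} (a : i ≤ j),
      preadditiveYoneda.map (X.map (homOfLE (hφ a))) ≫ t j = t i) :
    ∃ d : F ⟶ T, ∀ j, ι (φ j) ≫ d = t j :=
  (h.restrict hφ.functor hc).exists_desc t fun a => ht (leOfHom a)

end Cofinal

/-- Each section lives in a single representable, and injectivity into the union lets its relations
be checked there. -/
theorem isLeftExact [HasConflations E] [QuillenExact E] (h : IsUnion X ι) :
    isLeftExact E F := by
  intro A B C f g hfg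
  have := hfg.epi
  have inj : Function.Injective (res (F := F) g) := by
    refine (injective_iff_map_eq_zero _).2 fun x hx => ?_
    obtain ⟨i, s, rfl⟩ := h.exists_ap _ x
    rw [res_ap] at hx
    have := h.injective i _ (hx.trans (map_zero _).symm)
    rw [(cancel_epi g).1 (this.trans comp_zero.symm), map_zero]
  refine ⟨inj, fun y => ⟨fun hy => ?_, ?_⟩⟩
  · obtain ⟨i, s, rfl⟩ := h.exists_ap _ y
    obtain ⟨t, rfl⟩ := hfg.desc s (h.injective i _
      (((res_ap _ _ _).symm.trans hy).trans (map_zero _).symm))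
    exact ⟨ap (ι i) t, res_ap _ _ _⟩
  · rintro ⟨x, rfl⟩
    obtain ⟨i, s, rfl⟩ := h.exists_ap _ x
    change res f (res g _) = 0
    rw [res_ap, res_ap, ← Category.assoc, hfg.zero, zero_comp, map_zero]

end IsUnion

end Union

/-! ### Presentations of admissible Ind objects by preordered diagrams. -/

section IndPres

variable {E : Type u} [Category.{v} E] [Preadditive E] [HasConflations E] [QuillenExact E]

/-- A presheaf presented as the union of a diagram of admissible monics. -/
structure IndPres (κ : Cardinal.{v}) (F : Eᵒᵖ ⥤ AddCommGrpCat.{v}) where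
  I : Type v
  [preorder : Preorder I]
  [isDirected : IsDirectedOrder I]
  [nonempty : Nonempty I]
  card_le : Cardinal.mk I ≤ κ
  X : I ⥤ E
  admMono : ∀ {i j : I} (h : i ⟶ j), AdmMono (X.map h)
  ι : ∀ i, yo (X.obj i) ⟶ F
  isUnion : IsUnion X ι

attribute [instance] IndPres.preorder IndPres.isDirected IndPres.nonempty

variable {κ : Cardinal.{v}}

instance {I : Type v} [Preorder I] [IsDirectedOrder I] [Nonempty I] :
    PreservesColimitsOfShape I (forget AddCommGrpCat.{v}) := inferInstance

theorem exists_indPres {F : Lex E} (hF : isAdmInd E κ F) : Nonempty (IndPres κ F.obj) := by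
  obtain ⟨S, hS⟩ := hF
  obtain ⟨ι, hι⟩ := IsUnion.of_isColimitOf (fun a => (S.admMono a).mono) hS
  exact ⟨⟨S.I, S.card_le, S.X, S.admMono, ι, hι⟩⟩

/-- The index sets built below for extensions and pushouts are only preordered, whereas an
admissible Ind diagram needs a partial order. Representatives of the classes of equivalent indices
are cofinal. -/
theorem exists_partialOrder_replacement (I : Type w) [Preorder I] [IsDirectedOrder I] [Nonempty I] :
    ∃ (J : Type w) (_ : PartialOrder J) (_ : IsDirectedOrder J) (_ : Nonempty J)
      (_ : Cardinal.mk J ≤ Cardinal.mk I) (φ : J ↪o I), ∀ i, ∃ j, i ≤ φ j := by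
  have hφ (i : I) : i ≤ OrderEmbedding.ofAntisymmetrization I (toAntisymmetrization (· ≤ ·) i) :=
    toAntisymmetrization_le_toAntisymmetrization_iff.1
      (toAntisymmetrization_ofAntisymmetrization (· ≤ ·) (toAntisymmetrization (· ≤ ·) i)).ge
  refine ⟨Antisymmetrization I (· ≤ ·), inferInstance, ⟨fun a b => ?_⟩,
    ⟨toAntisymmetrization _ (Classical.arbitrary I)⟩, Cardinal.mk_quotient_le,
    OrderEmbedding.ofAntisymmetrization I, fun i => ⟨_, hφ i⟩⟩
  obtain ⟨c, hac, hbc⟩ := exists_ge_ge (OrderEmbedding.ofAntisymmetrization I a)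
    (OrderEmbedding.ofAntisymmetrization I b)
  exact ⟨toAntisymmetrization _ c,
    (OrderEmbedding.ofAntisymmetrization I).le_iff_le.1 (hac.trans (hφ c)),
    (OrderEmbedding.ofAntisymmetrization I).le_iff_le.1 (hbc.trans (hφ c))⟩

theorem IndPres.isLeftExact {F : Eᵒᵖ ⥤ AddCommGrpCat.{v}} (S : IndPres κ F) : isLeftExact E F :=
  S.isUnion.isLeftExact

theorem IndPres.isAdmInd {F : Lex E} (S : IndPres κ F.obj) : isAdmInd E κ F := by
  obtain ⟨J, _, _, _, hJ, φ, hφ⟩ := exists_partialOrder_replacement S.I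
  exact ⟨⟨J, hJ.trans S.card_le, φ.monotone.functor ⋙ S.X, fun h => S.admMono _⟩,
    (S.isUnion.restrict φ.monotone.functor hφ).isColimitOf⟩

/-- The object of `IndObj` with a given presentation. -/
def IndPres.toIndObj {F : Eᵒᵖ ⥤ AddCommGrpCat.{v}} (S : IndPres κ F) : IndObj E κ :=
  ⟨⟨F, S.isLeftExact⟩, S.isAdmInd⟩

end IndPres

/-! ### Extensions of admissible Ind objects -/

section Extensions

variable {E : Type u} [Category.{v} E] [Preadditive E]
  {F G H G' : Eᵒᵖ ⥤ AddCommGrpCat.{v}}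

theorem ev_add (α β : F ⟶ G) {A : E} (x : Sec F A) : ev (α + β) x = ev α x + ev β x := rfl

theorem yo_cancel {X Y : E} {ι : yo Y ⟶ F} (hι : ∀ A : E, Function.Injective (ap ι (A := A)))
    {a b : X ⟶ Y} (h : preadditiveYoneda.map a ≫ ι = preadditiveYoneda.map b ≫ ι) : a = b := by
  refine hι _ ?_
  simpa only [ap_map, Category.id_comp] using congrArg (fun t => ap t (𝟙 X)) h

variable [HasConflations E] [QuillenExact E]

theorem LexExact.comp_eq_zero {α : F ⟶ G} {β : G ⟶ H} (h : LexExact α β) : α ≫ β = 0 :=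
  hom_ext_ev fun _ x => h.zero x

/-- The presheaf represented by a pushout along an admissible monic is locally covered by the
presheaves represented by the two summands. -/
theorem locSurj_of_isPushout {X Y X' Y' : E} {f : X ⟶ Y} {a : X ⟶ X'} {b : Y ⟶ Y'}
    {f' : X' ⟶ Y'} (hp : IsPushout f a b f') (hf : AdmMono f) :
    LocSurj (prodPsh.fst (yo X') (yo Y) ≫ preadditiveYoneda.map f' +
      prodPsh.snd (yo X') (yo Y) ≫ preadditiveYoneda.map b) := by
  obtain ⟨Z, g, hg⟩ := hf
  have hc : Conflation f' (hp.desc g 0 (by rw [hg.zero, comp_zero])) := by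
    obtain ⟨Y₁, b₁, f₁, g₁, hp₁, hc₁, hb₁⟩ := hg.exists_pushout a
    refine QuillenExact.of_iso (Iso.refl _) (hp₁.isoIsPushout _ _ hp) (Iso.refl _) (by simp) ?_ hc₁
    apply hp₁.hom_ext <;> simp [hb₁, hc₁.zero]
  intro A y
  obtain ⟨B, q, t, hq, ht⟩ := AdmEpi.exists_lift ⟨_, _, hg⟩
    ((show A ⟶ Y' from y) ≫ hp.desc g 0 (by rw [hg.zero, comp_zero]))
  obtain ⟨s, hs⟩ := hc.lift (q ≫ (show A ⟶ Y' from y) - t ≫ b) (by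
    rw [Preadditive.sub_comp, Category.assoc, Category.assoc, hp.inl_desc, ht, sub_self])
  obtain ⟨z, hz₁, hz₂⟩ := exists_prodPsh (F := yo X') (G := yo Y) (A := B) s t
  refine ⟨B, q, z, hq, ?_⟩
  rw [ev_add, ev_comp, ev_comp, hz₁, hz₂]
  exact (eq_sub_iff_add_eq.1 hs)

/-- Yoneda need not turn `Y'` into a pushout of presheaves, but left exact `G` cannot see the
difference: `yo X'` and `yo Y` together cover `yo Y'`, and compatible maps descend along this cover.
-/
theorem exists_yo_desc (hG : isLeftExact E G) {X Y X' Y' : E} {f : X ⟶ Y} {a : X ⟶ X'}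
    {b : Y ⟶ Y'} {f' : X' ⟶ Y'} (hp : IsPushout f a b f') (hf : AdmMono f) (s : yo Y ⟶ G)
    (t : yo X' ⟶ G) (h : preadditiveYoneda.map f ≫ s = preadditiveYoneda.map a ≫ t) :
    ∃ d : yo Y' ⟶ G, preadditiveYoneda.map b ≫ d = s ∧ preadditiveYoneda.map f' ≫ d = t := by
  have hl := locSurj_of_isPushout hp hf
  have hf' := AdmMono.of_isPushout hp hf
  have := hf'.mono
  obtain ⟨d, hd⟩ := hl.exists_desc (isLeftExact_preadditiveYoneda E Y') hG
    (prodPsh.fst (yo X') (yo Y) ≫ t + prodPsh.snd (yo X') (yo Y) ≫ s) fun A n hn => by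
      obtain ⟨Z, g, hg⟩ := hf
      have hn' : (show A ⟶ X' from ev (prodPsh.fst (yo X') (yo Y)) n) ≫ f' +
        (show A ⟶ Y from ev (prodPsh.snd (yo X') (yo Y)) n) ≫ b = 0 := hn
      rw [ev_add, ev_comp, ev_comp]
      change ap t (show A ⟶ X' from ev (prodPsh.fst (yo X') (yo Y)) n) +
        ap s (show A ⟶ Y from ev (prodPsh.snd (yo X') (yo Y)) n) = 0
      generalize (show A ⟶ X' from ev (prodPsh.fst (yo X') (yo Y)) n) = x at *
      generalize (show A ⟶ Y from ev (prodPsh.snd (yo X') (yo Y)) n) = y at *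
      obtain ⟨k, rfl⟩ := hg.lift y (by
        have := congrArg (· ≫ hp.desc g 0 (by rw [hg.zero, comp_zero])) hn'
        simpa using this)
      have hx : x = -(k ≫ a) := by
        rw [← cancel_mono f', Preadditive.neg_comp, Category.assoc, ← hp.w, ← Category.assoc]
        exact eq_neg_of_add_eq_zero_left hn'
      rw [← ap_map, h, ap_map, hx, map_neg, neg_add_cancel]
  refine ⟨d, hom_ext_ap ?_, hom_ext_ap ?_⟩
  · obtain ⟨z, hz₁, hz₂⟩ := exists_prodPsh (F := yo X') (G := yo Y) (A := Y)
      (0 : Y ⟶ X') (𝟙 Y)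
    have := congrArg (fun r => ev r z) hd
    rw [ev_comp, ev_add, ev_add, ev_comp, ev_comp, ev_comp, ev_comp, hz₁, hz₂] at this
    have h2 : ap d ((0 : Y ⟶ X') ≫ f' + 𝟙 Y ≫ b) = ap t (0 : Y ⟶ X') + ap s (𝟙 Y) := this
    rwa [zero_comp, zero_add, map_zero, zero_add, ← ap_map] at h2
  · obtain ⟨z, hz₁, hz₂⟩ := exists_prodPsh (F := yo X') (G := yo Y) (A := X')
      (𝟙 X') (0 : X' ⟶ Y)
    have := congrArg (fun r => ev r z) hd
    rw [ev_comp, ev_add, ev_add, ev_comp, ev_comp, ev_comp, ev_comp, hz₁, hz₂] at this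
    have h2 : ap d (𝟙 X' ≫ f' + (0 : X' ⟶ Y) ≫ b) = ap t (𝟙 X') + ap s (0 : X' ⟶ Y) := this
    rwa [zero_comp, add_zero, map_zero, add_zero, ← ap_map] at h2

theorem yo_pushout_hom_ext (hG : isLeftExact E G) {X Y X' Y' : E} {f : X ⟶ Y} {a : X ⟶ X'}
    {b : Y ⟶ Y'} {f' : X' ⟶ Y'} (hp : IsPushout f a b f') (hf : AdmMono f) {s t : yo Y' ⟶ G}
    (h₁ : preadditiveYoneda.map b ≫ s = preadditiveYoneda.map b ≫ t)
    (h₂ : preadditiveYoneda.map f' ≫ s = preadditiveYoneda.map f' ≫ t) : s = t := by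
  refine (locSurj_of_isPushout hp hf).hom_ext hG ?_
  simp only [Preadditive.add_comp, Category.assoc, h₁, h₂]

theorem LexExact.injective_of_ends {α : F ⟶ G} {β : G ⟶ H} (h : LexExact α β)
    {X Y Z : E} {f : X ⟶ Y} {g : Y ⟶ Z} (hc : Conflation f g) {ξ : yo X ⟶ F} {υ : yo Y ⟶ G}
    {ζ : yo Z ⟶ H} (hf : preadditiveYoneda.map f ≫ υ = ξ ≫ α)
    (hg : υ ≫ β = preadditiveYoneda.map g ≫ ζ)
    (hξ : ∀ A : E, Function.Injective (ap ξ (A := A)))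
    (hζ : ∀ A : E, Function.Injective (ap ζ (A := A))) (A : E) :
    Function.Injective (ap υ (A := A)) := by
  refine (injective_iff_map_eq_zero _).2 fun y hy => ?_
  have h1 : ap ζ (y ≫ g) = 0 := by
    rw [← ap_map, ← hg, ap_comp, hy, map_zero]
  obtain ⟨x, rfl⟩ := hc.lift y (hζ _ (h1.trans (map_zero _).symm))
  have h2 : ev α (ap ξ x) = 0 := by rw [← ap_comp, ← hf, ap_map, hy]
  have h3 : x = 0 := hξ _ ((h.injective _ (h2.trans (map_zero _).symm)).trans (map_zero _).symm)
  rw [h3, zero_comp]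

/-- The short five lemma for left exact presheaves. -/
theorem LexExact.isIso_of_ends {α : F ⟶ G} {β : G ⟶ H} (h : LexExact α β) {α' : F ⟶ G'}
    {β' : G' ⟶ H} (h' : LexExact α' β') (hG : isLeftExact E G) (hG' : isLeftExact E G')
    {m : G ⟶ G'} (hα : α ≫ m = α') (hβ : m ≫ β' = β) : IsIso m := by
  have hm (A : E) : Function.Injective (ev m (A := A)) := by
    refine (injective_iff_map_eq_zero _).2 fun y hy => ?_
    obtain ⟨x, rfl⟩ := h.exact y (by rw [← hβ, ev_comp, hy, map_zero])
    rw [← ev_comp, hα] at hy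
    rw [h'.injective _ (hy.trans (map_zero _).symm), map_zero]
  refine isIso_of_bijective m hm fun A y => ?_
  obtain ⟨B, q, t, hq, ht⟩ := h.locSurj A (ev β' y)
  obtain ⟨s, hs⟩ := h'.exact (res q y - ev m t) (by
    rw [map_sub, ← ev_comp, hβ, ht, ev_res, sub_self])
  refine exists_of_locally hG hG' hm hq ⟨ev α s + t, ?_⟩
  rw [map_add, ← ev_comp, hα, hs, sub_add_cancel]

/-- The pushout of a conflation along a map into a piece of `F` maps to an extension by `F`. -/
theorem LexExact.exists_extension {α : F ⟶ G} {β : G ⟶ H} (h : LexExact α β)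
    (hG : isLeftExact E G) (hH : isLeftExact E H) {X K W Z : E} (ξ : yo X ⟶ F) (ζ : yo Z ⟶ H)
    {k : K ⟶ W} {p : W ⟶ Z} (hc : Conflation k p) (w : yo W ⟶ G)
    (hw : w ≫ β = preadditiveYoneda.map p ≫ ζ) (m : K ⟶ X)
    (hm : preadditiveYoneda.map m ≫ ξ ≫ α = preadditiveYoneda.map k ≫ w) :
    ∃ (Y : E) (f : X ⟶ Y) (g : Y ⟶ Z) (b : W ⟶ Y) (υ : yo Y ⟶ G), Conflation f g ∧ b ≫ g = p ∧
      preadditiveYoneda.map f ≫ υ = ξ ≫ α ∧ preadditiveYoneda.map b ≫ υ = w ∧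
      υ ≫ β = preadditiveYoneda.map g ≫ ζ := by
  obtain ⟨Y, b, f, g, hp, hfg, hb⟩ := hc.exists_pushout m
  obtain ⟨υ, h₁, h₂⟩ := exists_yo_desc hG hp ⟨_, _, hc⟩ w (ξ ≫ α) hm.symm
  refine ⟨Y, f, g, b, υ, hfg, hb, h₂, h₁, yo_pushout_hom_ext hH hp ⟨_, _, hc⟩ ?_ ?_⟩
  · rw [reassoc_of% h₁, hw, ← Functor.map_comp_assoc, hb]
  · rw [reassoc_of% h₂, h.comp_eq_zero, ← Functor.map_comp_assoc, hfg.zero, comp_zero,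
      Functor.map_zero, zero_comp]

/-- The Yoneda embedding reflects short exact sequences. -/
theorem conflation_of_lexExact {X Y Z : E} {f : X ⟶ Y} {g : Y ⟶ Z}
    (h : LexExact (preadditiveYoneda.map f) (preadditiveYoneda.map g)) : Conflation f g := by
  -- The identity of `Z` lifts to `Y` only after a cover `p`. Pushing the conflation of `p` out
  -- along the induced map `K ⟶ X` gives an extension of `Z` by `X`, identified with `Y` by the
  -- short five lemma.
  obtain ⟨W, p, w, ⟨K, k, hk⟩, hw⟩ := h.locSurj Z (𝟙 Z : Z ⟶ Z)
  change W ⟶ Y at w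
  have hw : w ≫ g = p := hw.trans (Category.comp_id p)
  obtain ⟨m, hm⟩ := h.exact (k ≫ w : K ⟶ Y) (by
    change (k ≫ w) ≫ g = 0
    rw [Category.assoc, hw, hk.zero])
  change K ⟶ X at m
  change m ≫ f = k ≫ w at hm
  obtain ⟨Y', f', g', b, υ, hc, hb, h₁, h₂, h₃⟩ := h.exists_extension
    (isLeftExact_preadditiveYoneda E Y) (isLeftExact_preadditiveYoneda E Z) (𝟙 _) (𝟙 _) hk
    (preadditiveYoneda.map w) (by rw [← Functor.map_comp, hw, Category.comp_id]) m
    (by rw [Category.id_comp, ← Functor.map_comp, ← Functor.map_comp, hm])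
  rw [Category.id_comp] at h₁
  rw [Category.comp_id] at h₃
  have := (LexExact.of_conflation hc).isIso_of_ends h (isLeftExact_preadditiveYoneda E _)
    (isLeftExact_preadditiveYoneda E _) h₁ h₃
  obtain ⟨y, rfl⟩ := exists_yo_map υ
  have : IsIso y := isIso_of_fully_faithful preadditiveYoneda y
  rw [← Functor.map_comp, yo_map_eq_iff] at h₁ h₃
  exact QuillenExact.of_iso (Iso.refl _) (asIso y) (Iso.refl _) (by simpa using h₁)
    (by simpa using h₃.symm) hc

/-- Pairs of indices that satisfy a relation. -/
structure RelPair {K I : Type v} (V : K → I → Prop) : Type v where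
  fst : K
  snd : I
  rel : V fst snd

theorem RelPair.card_le {K I : Type v} (V : K → I → Prop) {κ : Cardinal.{v}}
    (hκ : Cardinal.aleph0 ≤ κ) (hK : Cardinal.mk K ≤ κ) (hI : Cardinal.mk I ≤ κ) :
    Cardinal.mk (RelPair V) ≤ κ := by
  have : Function.Injective (fun p : RelPair V => (p.fst, p.snd)) := by
    rintro ⟨a, b, h⟩ ⟨a', b', h'⟩ e
    cases e
    rfl
  refine (Cardinal.mk_le_of_injective this).trans ?_
  rw [Cardinal.mk_prod, Cardinal.lift_id, Cardinal.lift_id]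
  exact (mul_le_mul' hK hI).trans (Cardinal.mul_eq_self hκ).le

/-- A short exact sequence of left exact presheaves with admissible Ind objects as its ends is the
union of a diagram of conflations. -/
theorem LexExact.exists_indPres {α : F ⟶ G} {β : G ⟶ H} (h : LexExact α β)
    (hG : isLeftExact E G) {κ : Cardinal.{v}} (hκ : Cardinal.aleph0 ≤ κ)
    (S : IndPres κ F) (R : IndPres κ H) :
    ∃ (P : IndPres κ G) (φ : P.I → S.I) (hφ : Monotone φ) (ψ : P.I → R.I) (hψ : Monotone ψ)
      (f : ∀ p, S.X.obj (φ p) ⟶ P.X.obj p) (g : ∀ p, P.X.obj p ⟶ R.X.obj (ψ p)),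
      (∀ {p q} (a : p ≤ q), S.X.map (homOfLE (hφ a)) ≫ f q = f p ≫ P.X.map (homOfLE a)) ∧
      (∀ {p q} (a : p ≤ q), P.X.map (homOfLE a) ≫ g q = g p ≫ R.X.map (homOfLE (hψ a))) ∧
      ∀ p, Conflation (f p) (g p) ∧
        preadditiveYoneda.map (f p) ≫ P.ι p = S.ι (φ p) ≫ α ∧
        P.ι p ≫ β = preadditiveYoneda.map (g p) ≫ R.ι (ψ p) := by
  have hH := R.isLeftExact
  -- Each piece of `H` gets a cover `W` with a lift to `G`; the kernel of the cover then maps to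
  -- `F`.
  have cover (k : R.I) : ∃ (K W : E) (κ : K ⟶ W) (p : W ⟶ R.X.obj k) (w : yo W ⟶ G),
      Conflation κ p ∧ w ≫ β = preadditiveYoneda.map p ≫ R.ι k := by
    obtain ⟨W, p, w, ⟨K, κ, hc⟩, hw⟩ := h.locSurj _ (ap (R.ι k) (𝟙 _))
    obtain ⟨ω, hω⟩ := hG.exists_ap w
    refine ⟨K, W, κ, p, ω, hc, hom_ext_ap ?_⟩
    rw [ap_comp, hω, res_id, hw, res_ap, ap_map, Category.comp_id, Category.id_comp]
  choose K W k p w hc hw using cover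
  -- A pair is admitted when the kernel over the `a`-th piece of `H` lands in the `i`-th piece of
  -- `F`. The pushout `Y` is then an extension of the former piece by the latter, sitting inside
  -- `G`.
  let V (a : R.I) (i : S.I) : Prop := ∃ m : K a ⟶ S.X.obj i,
    preadditiveYoneda.map m ≫ S.ι i ≫ α = preadditiveYoneda.map (k a) ≫ w a
  have V_mono {a : R.I} {i j : S.I} (hij : i ≤ j) (hV : V a i) : V a j := by
    obtain ⟨m, hm⟩ := hV
    refine ⟨m ≫ S.X.map (homOfLE hij), ?_⟩
    rw [Functor.map_comp_assoc, reassoc_of% (S.isUnion.comp (homOfLE hij)), hm]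
  have V_exists (a : R.I) : ∃ i, V a i := by
    obtain ⟨x, hx⟩ := h.exact (ap (w a) (k a)) (by
      rw [← ap_comp, hw, ap_map, (hc a).zero, map_zero])
    obtain ⟨i, m, rfl⟩ := S.isUnion.exists_ap _ x
    refine ⟨i, m, hom_ext_ap ?_⟩
    rw [ap_map, ap_comp, Category.id_comp, hx, ap_map, Category.id_comp]
  choose Y f g b υ hfg hb hf hbw hg using fun r : RelPair V =>
    h.exists_extension hG hH (S.ι r.snd) (R.ι r.fst) (hc r.fst) (w r.fst) (hw r.fst)
      r.rel.choose r.rel.choose_spec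
  have υ_inj (r : RelPair V) := h.injective_of_ends (hfg r) (hf r) (hg r)
    (S.isUnion.injective r.snd) (R.isUnion.injective r.fst)
  -- A section of `G` over the `a`-th piece differs locally from the chosen lift by a section of
  -- `F`, so it lies in the extension of index `(a, j)` for all large `j`. This yields both
  -- directedness and exhaustion of `G`.
  have absorb (a : R.I) {A : E} (x : Sec G A) (z : A ⟶ R.X.obj a) (hz : ap (R.ι a) z = ev β x) :
      ∃ j₀, ∀ j, j₀ ≤ j → ∀ v : V a j, ∃ s : A ⟶ Y ⟨a, j, v⟩, ap (υ ⟨a, j, v⟩) s = x := by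
    obtain ⟨B, q, t, hq, ht⟩ := AdmEpi.exists_lift ⟨_, _, hc a⟩ z
    obtain ⟨y, hy⟩ := h.exact (res q x - ap (w a) t) (by
      rw [map_sub, ev_res, ← hz, ← ap_comp, hw, ap_map, ht, res_ap, sub_self])
    obtain ⟨j₀, n, rfl⟩ := S.isUnion.exists_ap _ y
    refine ⟨j₀, fun j hj v => exists_of_locally (isLeftExact_preadditiveYoneda E _) hG
      (υ_inj _) hq ⟨((n ≫ S.X.map (homOfLE hj)) ≫ f ⟨a, j, v⟩ + t ≫ b ⟨a, j, v⟩ : B ⟶ _), ?_⟩⟩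
    change ap _ _ = _
    rw [map_add, ← ap_map, hf, ap_comp, S.isUnion.ap_map, hy, ← ap_map, hbw, sub_add_cancel]
  -- The covers are chosen independently for different pieces, so larger indices alone do not give
  -- inclusions; inclusion inside `G` is made part of the order.
  let _ : Preorder (RelPair V) :=
    { le := fun r s => r.fst ≤ s.fst ∧ r.snd ≤ s.snd ∧
        ∃ a : Y r ⟶ Y s, preadditiveYoneda.map a ≫ υ s = υ r
      le_refl := fun r => ⟨le_rfl, le_rfl, 𝟙 _,
        by rw [CategoryTheory.Functor.map_id, Category.id_comp]⟩
      le_trans := by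
        rintro r s t ⟨h₁, h₂, a, ha⟩ ⟨h₁', h₂', a', ha'⟩
        exact ⟨h₁.trans h₁', h₂.trans h₂', a ≫ a', by rw [Functor.map_comp_assoc, ha', ha]⟩ }
  choose T hT using fun (r s : RelPair V) (hrs : r ≤ s) => hrs.2.2
  let X : RelPair V ⥤ E :=
    { obj := Y
      map := fun {r s} hrs => T r s (leOfHom hrs)
      map_id := fun r => yo_cancel (υ_inj r) (by
        rw [hT, CategoryTheory.Functor.map_id, Category.id_comp])
      map_comp := fun {r s t} hrs hst => yo_cancel (υ_inj t) (by
        rw [hT, Functor.map_comp_assoc, hT, hT]) }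
  have hX {r s : RelPair V} (a : r ⟶ s) : preadditiveYoneda.map (X.map a) ≫ υ s = υ r := hT _ _ _
  have natf {r s : RelPair V} (a : r ≤ s) :
      S.X.map (homOfLE a.2.1) ≫ f s = f r ≫ T r s a :=
    yo_cancel (υ_inj s) (by
      rw [Functor.map_comp_assoc, Functor.map_comp_assoc, hT, hf, hf,
        reassoc_of% (S.isUnion.comp (homOfLE a.2.1))])
  have natg {r s : RelPair V} (a : r ≤ s) : T r s a ≫ g s = g r ≫ R.X.map (homOfLE a.1) :=
    yo_cancel (R.isUnion.injective s.fst) (by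
      rw [Functor.map_comp_assoc, Functor.map_comp_assoc, ← hg, reassoc_of% (hT r s a),
        R.isUnion.comp (homOfLE a.1), hg])
  have dir : IsDirectedOrder (RelPair V) := by
    refine ⟨fun r s => ?_⟩
    obtain ⟨a, hra, hsa⟩ := exists_ge_ge r.fst s.fst
    have key (t : RelPair V) (hta : t.fst ≤ a) := absorb a (ap (υ t) (𝟙 _))
      (g t ≫ R.X.map (homOfLE hta)) (by
        rw [R.isUnion.ap_map, ← ap_comp, hg, ap_map, Category.id_comp])
    obtain ⟨i₁, h₁⟩ := key r hra
    obtain ⟨i₂, h₂⟩ := key s hsa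
    obtain ⟨i₃, h₃⟩ := V_exists a
    obtain ⟨i₄, h₁₄, h₂₄⟩ := exists_ge_ge i₁ i₂
    obtain ⟨i₅, h₃₅, h₄₅⟩ := exists_ge_ge i₃ i₄
    obtain ⟨i₆, hr₆, hs₆⟩ := exists_ge_ge r.snd s.snd
    obtain ⟨i, h₅, h₆⟩ := exists_ge_ge i₅ i₆
    have v : V a i := V_mono (h₃₅.trans h₅) h₃
    exact ⟨⟨a, i, v⟩,
      ⟨hra, hr₆.trans h₆, exists_yo_map_comp _ (h₁ i ((h₁₄.trans h₄₅).trans h₅) v)⟩,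
      ⟨hsa, hs₆.trans h₆, exists_yo_map_comp _ (h₂ i ((h₂₄.trans h₄₅).trans h₅) v)⟩⟩
  have ne : Nonempty (RelPair V) :=
    ⟨⟨Classical.arbitrary R.I, _, (V_exists (Classical.arbitrary R.I)).choose_spec⟩⟩
  refine ⟨{ I := RelPair V
            card_le := RelPair.card_le V hκ R.card_le S.card_le
            X := X
            admMono := fun {r s} a => AdmMono.of_ends (hfg r) (hfg s) (natf (leOfHom a)).symm
              (natg (leOfHom a)).symm (S.admMono _) (R.admMono _)
            ι := υ
            isUnion := ⟨hX, υ_inj, fun A x => ?_⟩ },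
    RelPair.snd, fun _ _ a => a.2.1, RelPair.fst, fun _ _ a => a.1, f, g, natf, natg,
    fun r => ⟨hfg r, hf r, hg r⟩⟩
  obtain ⟨a, z, hz⟩ := R.isUnion.exists_ap A (ev β x)
  obtain ⟨j₀, hj₀⟩ := absorb a x z hz
  obtain ⟨i, hi⟩ := V_exists a
  obtain ⟨j, h₀, hij⟩ := exists_ge_ge j₀ i
  obtain ⟨s, hs⟩ := hj₀ j h₀ (V_mono hij hi)
  exact ⟨⟨a, j, V_mono hij hi⟩, s, hs⟩

end Extensions

/-! ### The exact category of admissible Ind objects -/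

section LexConstructions

variable {E : Type u} [Category.{v} E] [Preadditive E] [HasConflations E] [QuillenExact E]
  {F G H F' G' H' : Eᵒᵖ ⥤ AddCommGrpCat.{v}}

theorem LexExact.of_iso {α : F ⟶ G} {β : G ⟶ H} (h : LexExact α β) {α' : F' ⟶ G'} {β' : G' ⟶ H'}
    (a : F ≅ F') (b : G ≅ G') (c : H ≅ H') (h₁ : α ≫ b.hom = a.hom ≫ α')
    (h₂ : β ≫ c.hom = b.hom ≫ β') : LexExact α' β' := by
  have ha (A : E) := bijective_of_isIso a.hom A
  have hb (A : E) := bijective_of_isIso b.hom A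
  have hc (A : E) := bijective_of_isIso c.hom A
  have e₁ {A : E} (x : Sec F A) : ev α' (ev a.hom x) = ev b.hom (ev α x) :=
    (congrArg (fun r => ev r x) h₁).symm
  have e₂ {A : E} (x : Sec G A) : ev β' (ev b.hom x) = ev c.hom (ev β x) :=
    (congrArg (fun r => ev r x) h₂).symm
  refine ⟨fun A => (injective_iff_map_eq_zero _).2 fun x hx => ?_, fun {A} x => ?_,
    fun {A} y hy => ?_, fun A z => ?_⟩
  · obtain ⟨x, rfl⟩ := (ha A).2 x
    rw [e₁] at hx
    rw [h.injective A (((hb A).1 (hx.trans (map_zero _).symm)).trans (map_zero _).symm), map_zero]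
  · obtain ⟨x, rfl⟩ := (ha A).2 x
    rw [e₁, e₂, h.zero, map_zero]
  · obtain ⟨y, rfl⟩ := (hb A).2 y
    rw [e₂] at hy
    obtain ⟨x, rfl⟩ := h.exact y ((hc A).1 (hy.trans (map_zero _).symm))
    exact ⟨ev a.hom x, e₁ x⟩
  · obtain ⟨z, rfl⟩ := (hc A).2 z
    obtain ⟨B, q, t, hq, ht⟩ := h.locSurj A z
    exact ⟨B, q, ev b.hom t, hq, by rw [e₂, ht, ev_res]⟩

theorem LocSurj.comp {α : F ⟶ G} {β : G ⟶ H} (hα : LocSurj α) (hβ : LocSurj β) :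
    LocSurj (α ≫ β) := by
  intro A z
  obtain ⟨B, q, y, hq, hy⟩ := hβ A z
  obtain ⟨B', q', x, hq', hx⟩ := hα B y
  exact ⟨B', q' ≫ q, x, hq'.comp hq, by rw [ev_comp, hx, ev_res, hy, res_comp]⟩

/-- The pullback of a short exact sequence of left exact presheaves. -/
theorem LexExact.exists_pullback {α : F ⟶ G} {β : G ⟶ H} (h : LexExact α β)
    (hG : isLeftExact E G) (hH : isLeftExact E H) (hH' : isLeftExact E H') (ν : H' ⟶ H) :
    ∃ (K : Eᵒᵖ ⥤ AddCommGrpCat.{v}) (b : K ⟶ G) (α' : F ⟶ K) (β' : K ⟶ H'),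
      isLeftExact E K ∧ LexExact α' β' ∧ b ≫ β = β' ≫ ν ∧ α' ≫ b = α ∧
      (∀ (A : E) (x : Sec G A) (y : Sec H' A), ev β x = ev ν y →
        ∃ z : Sec K A, ev b z = x ∧ ev β' z = y) ∧
      ∀ (A : E) (z z' : Sec K A), ev b z = ev b z' → ev β' z = ev β' z' → z = z' := by
  let S (A : E) : AddSubgroup (Sec (prodPsh G H') A) :=
    ((ev (prodPsh.fst G H' ≫ β)) - (ev (prodPsh.snd G H' ≫ ν))).ker
  have memS {A : E} (x : Sec (prodPsh G H') A) :
      x ∈ S A ↔ ev β (ev (prodPsh.fst G H') x) = ev ν (ev (prodPsh.snd G H') x) :=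
    sub_eq_zero
  have hS {A B : E} (f : B ⟶ A) (x : Sec (prodPsh G H') A) (hx : x ∈ S A) : res f x ∈ S B := by
    rw [memS] at hx ⊢
    rw [ev_res, ev_res, ev_res, ev_res, hx]
  let i := subPshι S hS
  have hi (A : E) : Function.Injective (ev i (A := A)) := subPshι_injective A
  have hex (A : E) (x : Sec G A) (y : Sec H' A) (hxy : ev β x = ev ν y) :
      ∃ z, ev (i ≫ prodPsh.fst G H') z = x ∧ ev (i ≫ prodPsh.snd G H') z = y := by
    obtain ⟨z, rfl, rfl⟩ := exists_prodPsh x y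
    obtain ⟨t, ht⟩ := exists_subPshι (hS := hS) ((memS z).2 hxy)
    exact ⟨t, by rw [← ht]; rfl, by rw [← ht]; rfl⟩
  have hinj (A : E) (z z' : Sec (subPsh S hS) A)
      (h₁ : ev (i ≫ prodPsh.fst G H') z = ev (i ≫ prodPsh.fst G H') z')
      (h₂ : ev (i ≫ prodPsh.snd G H') z = ev (i ≫ prodPsh.snd G H') z') : z = z' :=
    hi A (prodPsh_ext h₁ h₂)
  have hw {A : E} (z : Sec (subPsh S hS) A) :
      ev β (ev (i ≫ prodPsh.fst G H') z) = ev ν (ev (i ≫ prodPsh.snd G H') z) :=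
    (memS _).1 (subPshι_mem z)
  obtain ⟨α', hα'⟩ := exists_hom_of_rel (F := F) (G := subPsh S hS)
    (fun A x z => ev (i ≫ prodPsh.fst G H') z = ev α x ∧ ev (i ≫ prodPsh.snd G H') z = 0)
    (fun A x => hex A _ _ (by rw [h.zero, map_zero]))
    (fun A x z z' hz hz' => hinj A z z' (hz.1.trans hz'.1.symm) (hz.2.trans hz'.2.symm))
    (fun A x x' z z' hz hz' => ⟨by rw [map_add, map_add, hz.1, hz'.1],
      by rw [map_add, hz.2, hz'.2, add_zero]⟩)
    (fun A B f x z hz => ⟨by rw [ev_res, ev_res, hz.1], by rw [ev_res, hz.2, map_zero]⟩)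
  have hα {A : E} (x : Sec F A) : ev (i ≫ prodPsh.fst G H') (ev α' x) = ev α x ∧
      ev (i ≫ prodPsh.snd G H') (ev α' x) = 0 := by
    obtain ⟨z, hz⟩ := hex A (ev α x) 0 (by rw [h.zero, map_zero])
    rw [hα' A x z hz]
    exact hz
  refine ⟨subPsh S hS, i ≫ prodPsh.fst G H', α', i ≫ prodPsh.snd G H',
    isLeftExact_subPsh (isLeftExact_prodPsh hG hH') fun p x hp hx => ?_,
    ⟨fun A x x' hx => h.injective A ?_, fun x => (hα x).2, fun {A} z hz => ?_, fun A y => ?_⟩,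
    hom_ext_ev fun A z => hw z, hom_ext_ev fun A x => (hα x).1, hex, hinj⟩
  · rw [memS] at hx ⊢
    exact hH.eq_of_res hp (by rw [← ev_res, ← ev_res, ← ev_res, ← ev_res, hx])
  · rw [← (hα x).1, ← (hα x').1, hx]
  · obtain ⟨x, hx⟩ := h.exact (ev (i ≫ prodPsh.fst G H') z) (by rw [hw, hz, map_zero])
    exact ⟨x, hinj A _ _ ((hα x).1.trans hx) ((hα x).2.trans hz.symm)⟩
  · obtain ⟨B, q, x, hq, hx⟩ := h.locSurj A (ev ν y)
    obtain ⟨z, -, hz⟩ := hex B x (res q y) (by rw [hx, ev_res])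
    exact ⟨B, q, z, hq, hz⟩

/-- The kernel of `β ≫ γ` is the preimage under `β` of the kernel of `γ`. This serves the
composition of admissible epics, where the preimage is again an Ind object as an extension of `K` by
`F`. -/
theorem LexExact.comp_epi {K F₁ : Eᵒᵖ ⥤ AddCommGrpCat.{v}} {α : F ⟶ G} {β : G ⟶ H}
    (h : LexExact α β) {κ : K ⟶ H} {γ : H ⟶ H'} (h' : LexExact κ γ) {b : F₁ ⟶ G} {α' : F ⟶ F₁}
    {β' : F₁ ⟶ K} (hp : LexExact α' β') (w : b ≫ β = β' ≫ κ) (hα : α' ≫ b = α)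
    (hex : ∀ (A : E) (x : Sec G A) (y : Sec K A), ev β x = ev κ y →
        ∃ z : Sec F₁ A, ev b z = x ∧ ev β' z = y) : LexExact b (β ≫ γ) where
  injective A := by
    refine (injective_iff_map_eq_zero _).2 fun z hz => ?_
    have h1 : ev κ (ev β' z) = 0 := by rw [← ev_comp, ← w, ev_comp, hz, map_zero]
    obtain ⟨x, rfl⟩ := hp.exact z (h'.injective A (h1.trans (map_zero _).symm))
    rw [← ev_comp, hα] at hz
    rw [h.injective A (hz.trans (map_zero _).symm), map_zero]
  zero z := by
    rw [← ev_comp, reassoc_of% w, h'.comp_eq_zero, comp_zero, ev_zero]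
  exact y hy := by
    obtain ⟨t, ht⟩ := h'.exact (ev β y) hy
    obtain ⟨z, hz, -⟩ := hex _ y t ht.symm
    exact ⟨z, hz⟩
  locSurj := h.locSurj.comp h'.locSurj

/-- The cokernel of `α ≫ α₂` is the pushout of `H` along `β`, an extension of `R` by `Q`. This
serves the composition of admissible monics. -/
theorem LexExact.comp_mono {Q R : Eᵒᵖ ⥤ AddCommGrpCat.{v}} {α : F ⟶ G} {β : G ⟶ Q}
    (h : LexExact α β) {α₂ : G ⟶ H} {β₂ : H ⟶ R} (h₂ : LexExact α₂ β₂) {φ : Q ⟶ G'} {γ : H ⟶ G'}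
    {β' : G' ⟶ R} (h' : LexExact φ β') (w : α₂ ≫ γ = β ≫ φ) (hβ : γ ≫ β' = β₂) :
    LexExact (α ≫ α₂) γ where
  injective A := (h₂.injective A).comp (h.injective A)
  zero x := by rw [← ev_comp, Category.assoc, w, reassoc_of% h.comp_eq_zero, zero_comp, ev_zero]
  exact {A} y hy := by
    obtain ⟨g, rfl⟩ := h₂.exact y (by rw [← hβ, ev_comp, hy, map_zero])
    rw [← ev_comp, w, ev_comp] at hy
    obtain ⟨x, rfl⟩ := h.exact g (h'.injective A (hy.trans (map_zero _).symm))
    exact ⟨x, rfl⟩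
  locSurj A y := by
    obtain ⟨B, q, t, hq, ht⟩ := h₂.locSurj A (ev β' y)
    obtain ⟨x, hx⟩ := h'.exact (res q y - ev γ t) (by
      rw [map_sub, ← ev_comp, hβ, ht, ev_res, sub_self])
    obtain ⟨B', q', g, hq', hg⟩ := h.locSurj B x
    refine ⟨B', q' ≫ q, res q' t + ev α₂ g, hq'.comp hq, ?_⟩
    rw [map_add, ← ev_comp α₂, w, ev_comp, hg, ev_res, ev_res, hx, ← map_add, add_sub_cancel,
      res_comp]

/-- The universal property of the pushout of a short exact sequence. -/
theorem LexExact.pushout_desc {T : Eᵒᵖ ⥤ AddCommGrpCat.{v}} {α : F ⟶ G} {β : G ⟶ H}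
    (h : LexExact α β) {μ : F ⟶ F'} {φ : F' ⟶ G'} {γ : G ⟶ G'} {β' : G' ⟶ H}
    (h' : LexExact φ β') (w : α ≫ γ = μ ≫ φ) (hβ : γ ≫ β' = β) (hG' : isLeftExact E G')
    (hT : isLeftExact E T) :
    (∀ (s : G ⟶ T) (t : F' ⟶ T), α ≫ s = μ ≫ t → ∃ d : G' ⟶ T, γ ≫ d = s ∧ φ ≫ d = t) ∧
    ∀ d d' : G' ⟶ T, γ ≫ d = γ ≫ d' → φ ≫ d = φ ≫ d' → d = d' := by
  have hl : LocSurj (prodPsh.fst F' G ≫ φ + prodPsh.snd F' G ≫ γ) := by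
    intro A y
    obtain ⟨B, q, t, hq, ht⟩ := h.locSurj A (ev β' y)
    obtain ⟨x, hx⟩ := h'.exact (res q y - ev γ t) (by
      rw [map_sub, ← ev_comp, hβ, ht, ev_res, sub_self])
    obtain ⟨z, hz₁, hz₂⟩ := exists_prodPsh x t
    exact ⟨B, q, z, hq, by rw [ev_add, ev_comp, ev_comp, hz₁, hz₂, hx, sub_add_cancel]⟩
  constructor
  · intro s t hst
    obtain ⟨d, hd⟩ := hl.exists_desc hG' hT (prodPsh.fst F' G ≫ t + prodPsh.snd F' G ≫ s)
      fun A n hn => by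
        rw [ev_add, ev_comp, ev_comp] at hn ⊢
        generalize ev (prodPsh.fst F' G) n = x at *
        generalize ev (prodPsh.snd F' G) n = y at *
        obtain ⟨x₀, rfl⟩ := h.exact y (by
          have := congrArg (ev β') hn
          rwa [map_add, h'.zero, zero_add, ← ev_comp, hβ, map_zero] at this)
        rw [← ev_comp, w, ev_comp, ← map_add] at hn
        have hx := h'.injective A (hn.trans (map_zero _).symm)
        rw [← ev_comp, hst, ev_comp, ← map_add, hx, map_zero]
    refine ⟨d, hom_ext_ev fun A y => ?_, hom_ext_ev fun A x => ?_⟩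
    · obtain ⟨z, hz₁, hz₂⟩ := exists_prodPsh (0 : Sec F' A) y
      have := congrArg (fun r => ev r z) hd
      rw [ev_comp, ev_add, ev_add, ev_comp, ev_comp, ev_comp, ev_comp, hz₁, hz₂, map_zero, zero_add,
        map_zero, zero_add] at this
      exact this
    · obtain ⟨z, hz₁, hz₂⟩ := exists_prodPsh x (0 : Sec G A)
      have := congrArg (fun r => ev r z) hd
      rw [ev_comp, ev_add, ev_add, ev_comp, ev_comp, ev_comp, ev_comp, hz₁, hz₂, map_zero, add_zero,
        map_zero, add_zero] at this
      exact this
  · intro d d' h₁ h₂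
    refine hl.hom_ext hT ?_
    simp only [Preadditive.add_comp, Category.assoc, h₁, h₂]

/-- The pushout of a short exact sequence of admissible Ind objects. -/
theorem LexExact.exists_pushout {α : F ⟶ G} {β : G ⟶ H} (h : LexExact α β)
    (hG : isLeftExact E G) {κ : Cardinal.{v}} (hκ : Cardinal.aleph0 ≤ κ)
    (S : IndPres κ F) (R : IndPres κ H) (S' : IndPres κ F') (μ : F ⟶ F') :
    ∃ (G' : Eᵒᵖ ⥤ AddCommGrpCat.{v}) (_ : IndPres κ G') (φ : F' ⟶ G') (γ : G ⟶ G') (β' : G' ⟶ H),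
      LexExact φ β' ∧ α ≫ γ = μ ≫ φ ∧ γ ≫ β' = β := by
  obtain ⟨P, ρ, hρ, ψ, hψ, f, g, natf, natg, hP⟩ := h.exists_indPres hG hκ S R
  -- Pairs for which `μ` carries the subobject of the `p`-th conflation into the `j`-th piece of
  -- `F'`. The conflations are pushed out stage by stage, the transition maps are admissible monics
  -- by `AdmMono.of_ends`, and `G'` is the union.
  let V (p : P.I) (j : S'.I) : Prop := ∃ m : S.X.obj (ρ p) ⟶ S'.X.obj j,
    preadditiveYoneda.map m ≫ S'.ι j = S.ι (ρ p) ≫ μ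
  have V_mono {p : P.I} {i j : S'.I} (hij : i ≤ j) (hV : V p i) : V p j := by
    obtain ⟨m, hm⟩ := hV
    exact ⟨m ≫ S'.X.map (homOfLE hij), by
      rw [Functor.map_comp_assoc, S'.isUnion.comp (homOfLE hij), hm]⟩
  have V_exists (p : P.I) : ∃ j, V p j := by
    obtain ⟨j, m, hm⟩ := S'.isUnion.exists_ap _ (ap (S.ι (ρ p) ≫ μ) (𝟙 _))
    exact ⟨j, m, hom_ext_ap (by rw [ap_map, Category.id_comp, hm])⟩
  have V_exists' (p : P.I) (i : S'.I) : ∃ j, i ≤ j ∧ V p j := by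
    obtain ⟨j, hj⟩ := V_exists p
    obtain ⟨k, hik, hjk⟩ := exists_ge_ge i j
    exact ⟨k, hik, V_mono hjk hj⟩
  choose m hm using fun r : RelPair V => r.rel
  choose Y b f' g' hpo hc hb using fun r : RelPair V => (hP r.fst).1.exists_pushout (m r)
  let _ : Preorder (RelPair V) :=
    { le := fun r s => r.fst ≤ s.fst ∧ r.snd ≤ s.snd
      le_refl := fun r => ⟨le_rfl, le_rfl⟩
      le_trans := fun r s t h h' => ⟨h.1.trans h'.1, h.2.trans h'.2⟩ }
  have dir : IsDirectedOrder (RelPair V) := by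
    refine ⟨fun r s => ?_⟩
    obtain ⟨p, hrp, hsp⟩ := exists_ge_ge r.fst s.fst
    obtain ⟨i, hri, hsi⟩ := exists_ge_ge r.snd s.snd
    obtain ⟨j, hij, hj⟩ := V_exists' p i
    exact ⟨⟨p, j, hj⟩, ⟨hrp, hri.trans hij⟩, ⟨hsp, hsi.trans hij⟩⟩
  have ne : Nonempty (RelPair V) :=
    ⟨⟨Classical.arbitrary P.I, _, (V_exists (Classical.arbitrary P.I)).choose_spec⟩⟩
  have hmm {r s : RelPair V} (a : r ≤ s) : S.X.map (homOfLE (hρ a.1)) ≫ m s =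
      m r ≫ S'.X.map (homOfLE a.2) :=
    yo_cancel (S'.isUnion.injective s.snd) (by
      rw [Functor.map_comp_assoc, Functor.map_comp_assoc, hm, S'.isUnion.comp (homOfLE a.2), hm,
        reassoc_of% (S.isUnion.comp (homOfLE (hρ a.1)))])
  have hT (r s : RelPair V) (a : r ≤ s) : ∃ t : Y r ⟶ Y s,
      b r ≫ t = P.X.map (homOfLE a.1) ≫ b s ∧ f' r ≫ t = S'.X.map (homOfLE a.2) ≫ f' s :=
    ⟨(hpo r).desc (P.X.map (homOfLE a.1) ≫ b s) (S'.X.map (homOfLE a.2) ≫ f' s) (by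
      rw [← reassoc_of% (hmm a), ← (hpo s).w]
      rw [reassoc_of% (natf a.1)]),
      (hpo r).inl_desc _ _ _, (hpo r).inr_desc _ _ _⟩
  choose T hTb hTf using hT
  let X : RelPair V ⥤ E :=
    { obj := Y
      map := fun {r s} a => T r s (leOfHom a)
      map_id := fun r => by
        apply (hpo r).hom_ext
        · rw [hTb, Category.comp_id]
          exact (congrArg (· ≫ b r) (P.X.map_id _)).trans (Category.id_comp _)
        · rw [hTf, Category.comp_id]
          exact (congrArg (· ≫ f' r) (S'.X.map_id _)).trans (Category.id_comp _)
      map_comp := fun {r s t} a a' => by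
        apply (hpo r).hom_ext
        · rw [hTb, reassoc_of% (hTb r s (leOfHom a)), hTb, ← Functor.map_comp_assoc, homOfLE_comp]
        · rw [hTf, reassoc_of% (hTf r s (leOfHom a)), hTf, ← Functor.map_comp_assoc,
            homOfLE_comp] }
  have hTg {r s : RelPair V} (a : r ≤ s) :
      g' r ≫ R.X.map (homOfLE (hψ a.1)) = T r s a ≫ g' s := by
    apply (hpo r).hom_ext
    · rw [reassoc_of% (hb r), reassoc_of% (hTb r s a), hb]
      exact (natg a.1).symm
    · rw [reassoc_of% (hc r).zero, reassoc_of% (hTf r s a), (hc s).zero, zero_comp, comp_zero]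
  have hX {r s : RelPair V} (a : r ⟶ s) : AdmMono (X.map a) :=
    AdmMono.of_ends (hc r) (hc s) (hTf r s (leOfHom a)) (hTg (leOfHom a)) (S'.admMono _)
      (R.admMono _)
  obtain ⟨G', ι, hι⟩ := IsUnion.exists_isUnion X fun a => (hX a).mono
  have hι' {r s : RelPair V} (a : r ≤ s) : preadditiveYoneda.map (T r s a) ≫ ι s = ι r :=
    hι.comp (homOfLE a)
  have m₁ : Monotone (RelPair.fst (V := V)) := fun _ _ a => a.1
  have m₂ : Monotone (RelPair.snd (V := V)) := fun _ _ a => a.2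
  have c₁ (p : P.I) : ∃ r : RelPair V, p ≤ r.fst := ⟨⟨p, _, (V_exists p).choose_spec⟩, le_rfl⟩
  have c₂ (j : S'.I) : ∃ r : RelPair V, j ≤ r.snd := by
    obtain ⟨k, hjk, hk⟩ := V_exists' (Classical.arbitrary P.I) j
    exact ⟨⟨_, k, hk⟩, hjk⟩
  obtain ⟨γ, hγ⟩ := P.isUnion.exists_desc_cofinal (J := RelPair V) (φ := RelPair.fst) (T := G') m₁
    c₁ (fun r => preadditiveYoneda.map (b r) ≫ ι r) fun {r s} a => by
      rw [← hι' a, ← Functor.map_comp_assoc, ← Functor.map_comp_assoc, hTb r s a]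
  obtain ⟨φ, hφ⟩ := S'.isUnion.exists_desc_cofinal (J := RelPair V) (φ := RelPair.snd) (T := G') m₂
    c₂ (fun r => preadditiveYoneda.map (f' r) ≫ ι r) fun {r s} a => by
      rw [← hι' a, ← Functor.map_comp_assoc, ← Functor.map_comp_assoc, hTf r s a]
  obtain ⟨β', hβ'⟩ := hι.exists_desc
    (fun r => preadditiveYoneda.map (g' r) ≫ R.ι (ψ r.fst)) fun {r s} a => by
      rw [← R.isUnion.comp (homOfLE (hψ (leOfHom a).1)), ← Functor.map_comp_assoc,
        ← Functor.map_comp_assoc, hTg (leOfHom a)]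
  have hγβ : γ ≫ β' = β := P.isUnion.hom_ext_cofinal c₁ fun r => by
    rw [reassoc_of% (hγ r), hβ', ← Functor.map_comp_assoc, hb]
    exact (hP r.fst).2.2.symm
  have hγ' (r : RelPair V) {A : E} (y : A ⟶ P.X.obj r.fst) :
      ev γ (ap (P.ι r.fst) y) = ap (ι r) (y ≫ b r) := by
    rw [← ap_map, ← hγ, ap_comp]
  have hφ' (r : RelPair V) {A : E} (y : A ⟶ S'.X.obj r.snd) :
      ev φ (ap (S'.ι r.snd) y) = ap (ι r) (y ≫ f' r) := by
    rw [← ap_map, ← hφ, ap_comp]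
  refine ⟨G', ⟨RelPair V, RelPair.card_le V hκ P.card_le S'.card_le, X, hX, ι, hι⟩, φ, γ, β',
    ⟨fun A => (injective_iff_map_eq_zero _).2 fun x hx => ?_, fun x => ?_, fun {A} y hy => ?_,
      fun A z => ?_⟩, hom_ext_ev fun A x => ?_, hγβ⟩
  · obtain ⟨r, s, rfl⟩ := S'.isUnion.exists_ap_cofinal c₂ A x
    have := (hc r).mono
    have h1 := hι.injective r A (((hφ' r s).symm.trans hx).trans (map_zero _).symm)
    have h2 : s = 0 := (cancel_mono (f' r)).1 (h1.trans zero_comp.symm)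
    rw [h2, map_zero]
  · rw [← ev_comp]
    have : φ ≫ β' = 0 := S'.isUnion.hom_ext_cofinal c₂ fun r => by
      rw [reassoc_of% (hφ r), hβ', ← Functor.map_comp_assoc, (hc r).zero, comp_zero,
        Functor.map_zero, zero_comp]
    rw [this, ev_zero]
  · obtain ⟨r, y, rfl⟩ := hι.exists_ap A y
    rw [← ap_comp, hβ', ap_map] at hy
    obtain ⟨s, rfl⟩ := (hc r).lift y (R.isUnion.injective _ A (hy.trans (map_zero _).symm))
    exact ⟨ap (S'.ι r.snd) s, hφ' r s⟩
  · obtain ⟨B, q, t, hq, ht⟩ := h.locSurj A z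
    exact ⟨B, q, ev γ t, hq, by rw [← ev_comp, hγβ, ht]⟩
  · obtain ⟨r, y, hy⟩ := P.isUnion.exists_ap_cofinal c₁ A (ev α x)
    have h1 : ap (R.ι (ψ r.fst)) (y ≫ g r.fst) = 0 := by
      rw [← ap_map, ← (hP r.fst).2.2, ap_comp, hy, h.zero]
    obtain ⟨s, rfl⟩ := (hP r.fst).1.lift y (R.isUnion.injective _ A (h1.trans (map_zero _).symm))
    have hx : ap (S.ι (ρ r.fst)) s = x := h.injective A (by
      rw [← hy, ← ap_map, (hP r.fst).2.1, ap_comp])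
    rw [ev_comp, ev_comp, ← hy, hγ', Category.assoc, (hpo r).w, ← hx, ← ap_comp, ← hm r, ap_map,
      hφ', Category.assoc]

end LexConstructions

/-! ### Quillen's axioms for admissible Ind objects. -/

section IndExact

theorem isKernelCokernelPair_of_hom {A : Type u} [Category.{v} A] [Preadditive A]
    {P : ObjectProperty A} {X Y Z : P.FullSubcategory} {f : X ⟶ Y} {g : Y ⟶ Z}
    (h : IsKernelCokernelPair f.hom g.hom) : IsKernelCokernelPair f g := by
  obtain ⟨w, ⟨hf⟩, ⟨hg⟩⟩ := h
  have hl {K : P.FullSubcategory} (t : K ⟶ Y) (ht : t ≫ g = 0) : ∃ s : K ⟶ X, s ≫ f = t := by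
    obtain ⟨l, hl⟩ := KernelFork.IsLimit.lift' hf t.hom (congrArg (fun r => r.hom) ht)
    exact ⟨ObjectProperty.homMk l, ObjectProperty.hom_ext _ hl⟩
  have hd {K : P.FullSubcategory} (t : Y ⟶ K) (ht : f ≫ t = 0) : ∃ s : Z ⟶ K, g ≫ s = t := by
    obtain ⟨l, hl⟩ := CokernelCofork.IsColimit.desc' hg t.hom (congrArg (fun r => r.hom) ht)
    exact ⟨ObjectProperty.homMk l, ObjectProperty.hom_ext _ hl⟩
  exact ⟨ObjectProperty.hom_ext _ w,
    ⟨KernelFork.IsLimit.ofι _ _ (fun t ht => (hl t ht).choose)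
      (fun t ht => (hl t ht).choose_spec) fun t ht m hm => ObjectProperty.hom_ext _
        (Fork.IsLimit.hom_ext hf (congrArg (fun r => r.hom)
          (hm.trans (hl t ht).choose_spec.symm)))⟩,
    ⟨CokernelCofork.IsColimit.ofπ _ _ (fun t ht => (hd t ht).choose)
      (fun t ht => (hd t ht).choose_spec) fun t ht m hm => ObjectProperty.hom_ext _
        (Cofork.IsColimit.hom_ext hg
          (congrArg (fun r => r.hom) (hm.trans (hd t ht).choose_spec.symm)))⟩⟩

variable {E : Type u} [Category.{v} E] [Preadditive E] [HasConflations E] [QuillenExact E]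
  {κ : Cardinal.{v}}

theorem conflation_ind_iff {F G H : IndObj E κ} {α : F ⟶ G} {β : G ⟶ H} :
    Conflation α β ↔ LexExact α.hom.hom β.hom.hom :=
  conflation_lex_iff

/-- A morphism of admissible Ind objects from a morphism of presheaves. -/
def indHom {F G : IndObj E κ} (α : F.obj.obj ⟶ G.obj.obj) : F ⟶ G :=
  ObjectProperty.homMk (ObjectProperty.homMk α)

theorem indHom_ext {F G : IndObj E κ} {α β : F ⟶ G} (h : α.hom.hom = β.hom.hom) : α = β :=
  ObjectProperty.hom_ext _ (ObjectProperty.hom_ext _ h)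

theorem ind_pres (F : IndObj E κ) : Nonempty (IndPres κ F.obj.obj) := exists_indPres F.property

/-- The isomorphism of presheaves underlying an isomorphism of admissible Ind objects. -/
def indIso {F G : IndObj E κ} (e : F ≅ G) : F.obj.obj ≅ G.obj.obj where
  hom := e.hom.hom.hom
  inv := e.inv.hom.hom
  hom_inv_id := congrArg (fun r => r.hom.hom) e.hom_inv_id
  inv_hom_id := congrArg (fun r => r.hom.hom) e.inv_hom_id

theorem isPushout_of_lexExact {F G H F' G' : IndObj E κ} {α : F ⟶ G} {β : G ⟶ H} {μ : F ⟶ F'}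
    {φ : F' ⟶ G'} {γ : G ⟶ G'} {β' : G' ⟶ H} (h : Conflation α β) (h' : Conflation φ β')
    (w : α ≫ γ = μ ≫ φ) (hβ : γ ≫ β' = β) : IsPushout α μ γ φ := by
  have key (T : IndObj E κ) := (conflation_ind_iff.1 h).pushout_desc (T := T.obj.obj)
    (conflation_ind_iff.1 h') (μ := μ.hom.hom) (γ := γ.hom.hom)
    (congrArg (fun r => r.hom.hom) w) (congrArg (fun r => r.hom.hom) hβ) G'.obj.property
    T.obj.property
  have hd (s : PushoutCocone α μ) : ∃ d : G' ⟶ s.pt, γ ≫ d = s.inl ∧ φ ≫ d = s.inr := by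
    obtain ⟨d, h₁, h₂⟩ := (key s.pt).1 s.inl.hom.hom s.inr.hom.hom
      (congrArg (fun r => r.hom.hom) s.condition)
    exact ⟨indHom d, indHom_ext h₁, indHom_ext h₂⟩
  refine ⟨⟨w⟩, ⟨PushoutCocone.IsColimit.mk _ (fun s => (hd s).choose)
    (fun s => (hd s).choose_spec.1) (fun s => (hd s).choose_spec.2) fun s m h₁ h₂ => ?_⟩⟩
  exact indHom_ext ((key s.pt).2 _ _
    (congrArg (fun r => r.hom.hom) (h₁.trans (hd s).choose_spec.1.symm))
    (congrArg (fun r => r.hom.hom) (h₂.trans (hd s).choose_spec.2.symm)))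

variable [hκ : Fact (Cardinal.aleph0 ≤ κ)]

theorem exists_ind_pushout {F G H F' : IndObj E κ} {α : F ⟶ G} {β : G ⟶ H} (h : Conflation α β)
    (μ : F ⟶ F') : ∃ (G' : IndObj E κ) (φ : F' ⟶ G') (γ : G ⟶ G') (β' : G' ⟶ H),
      Conflation φ β' ∧ α ≫ γ = μ ≫ φ ∧ γ ≫ β' = β := by
  obtain ⟨S⟩ := ind_pres F
  obtain ⟨R⟩ := ind_pres H
  obtain ⟨S'⟩ := ind_pres F'
  obtain ⟨G', P, φ, γ, β', h', w, hβ⟩ := (conflation_ind_iff.1 h).exists_pushout G.obj.property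
    hκ.out S R S' μ.hom.hom
  exact ⟨P.toIndObj, indHom φ, indHom γ, indHom β', conflation_ind_iff.2 h', indHom_ext w,
    indHom_ext hβ⟩

theorem exists_ind_pullback {F G H H' : IndObj E κ} {α : F ⟶ G} {β : G ⟶ H} (h : Conflation α β)
    (ν : H' ⟶ H) : ∃ (K : IndObj E κ) (b : K ⟶ G) (α' : F ⟶ K) (β' : K ⟶ H'),
      Conflation α' β' ∧ b ≫ β = β' ≫ ν ∧ α' ≫ b = α ∧
      (∀ (A : E) (x : Sec G.obj.obj A) (y : Sec H'.obj.obj A), ev β.hom.hom x = ev ν.hom.hom y →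
        ∃ z : Sec K.obj.obj A, ev b.hom.hom z = x ∧ ev β'.hom.hom z = y) ∧
      IsPullback b β' β ν := by
  obtain ⟨S⟩ := ind_pres F
  obtain ⟨R⟩ := ind_pres H'
  obtain ⟨K, b, α', β', hK, h', w, hα, hex, hinj⟩ := (conflation_ind_iff.1 h).exists_pullback
    G.obj.property H.obj.property H'.obj.property ν.hom.hom
  obtain ⟨P, -⟩ := h'.exists_indPres hK hκ.out S R
  have hl (s : PullbackCone β ν) : ∃ d : s.pt ⟶ P.toIndObj, d ≫ indHom (F := P.toIndObj) b = s.fst ∧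
      d ≫ indHom (F := P.toIndObj) β' = s.snd := by
    obtain ⟨d, hd⟩ := exists_hom_of_rel (F := s.pt.obj.obj) (G := K)
      (fun A x z => ev b z = ev s.fst.hom.hom x ∧ ev β' z = ev s.snd.hom.hom x)
      (fun A x => hex A _ _ (congrArg (fun r => ev r.hom.hom x) s.condition))
      (fun A x z z' hz hz' => hinj A z z' (hz.1.trans hz'.1.symm) (hz.2.trans hz'.2.symm))
      (fun A x x' z z' hz hz' => ⟨by rw [map_add, map_add, hz.1, hz'.1],
        by rw [map_add, map_add, hz.2, hz'.2]⟩)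
      (fun A B f x z hz => ⟨by rw [ev_res, ev_res, hz.1], by rw [ev_res, ev_res, hz.2]⟩)
    have hd' {A : E} (x : Sec s.pt.obj.obj A) :
        ev b (ev d x) = ev s.fst.hom.hom x ∧ ev β' (ev d x) = ev s.snd.hom.hom x := by
      obtain ⟨z, hz⟩ := hex A _ _ (congrArg (fun r => ev r.hom.hom x) s.condition)
      rw [hd A x z hz]
      exact hz
    exact ⟨indHom d, indHom_ext (hom_ext_ev fun A x => (hd' x).1),
      indHom_ext (hom_ext_ev fun A x => (hd' x).2)⟩
  refine ⟨P.toIndObj, indHom b, indHom α', indHom β', conflation_ind_iff.2 h', indHom_ext w,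
    indHom_ext hα, hex, ⟨⟨indHom_ext w⟩, ⟨PullbackCone.IsLimit.mk _ (fun s => (hl s).choose)
    (fun s => (hl s).choose_spec.1) (fun s => (hl s).choose_spec.2) fun s m h₁ h₂ => ?_⟩⟩⟩
  refine indHom_ext (hom_ext_ev fun A x => hinj A _ _ ?_ ?_)
  · exact congrArg (fun r => ev r.hom.hom x) (h₁.trans (hl s).choose_spec.1.symm)
  · exact congrArg (fun r => ev r.hom.hom x) (h₂.trans (hl s).choose_spec.2.symm)

theorem isZero_toInd {O : E} (hO : IsZero O) : IsZero ((toInd E κ).obj O) := by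
  rw [IsZero.iff_id_eq_zero]
  exact indHom_ext (hom_ext_ev fun A (x : A ⟶ O) => hO.eq_of_tgt x 0)

theorem ind_conflation_zero_id (F : IndObj E κ) {O : IndObj E κ} (hO : IsZero O) :
    Conflation (0 : O ⟶ F) (𝟙 F) := by
  have hO' {A : E} (x : Sec O.obj.obj A) : x = 0 :=
    congrArg (fun r : O ⟶ O => ev r.hom.hom x) (hO.eq_of_src (𝟙 O) 0)
  exact conflation_ind_iff.2 ⟨fun A x y _ => (hO' x).trans (hO' y).symm, fun x => rfl,
    fun {A} y hy => ⟨0, (map_zero _).trans (Eq.symm hy)⟩,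
    fun A x => ⟨A, 𝟙 A, x, AdmEpi.id A, (res_id x).symm⟩⟩

theorem ind_conflation_id_zero (F : IndObj E κ) {O : IndObj E κ} (hO : IsZero O) :
    Conflation (𝟙 F) (0 : F ⟶ O) := by
  have hO' {A : E} (x : Sec O.obj.obj A) : x = 0 :=
    congrArg (fun r : O ⟶ O => ev r.hom.hom x) (hO.eq_of_src (𝟙 O) 0)
  exact conflation_ind_iff.2 ⟨fun A x y h => h, fun x => rfl,
    fun {A} y _ => ⟨y, rfl⟩,
    fun A x => ⟨A, 𝟙 A, 0, AdmEpi.id A, (hO' _).trans (hO' _).symm⟩⟩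

variable (E κ)

open scoped ZeroObject

instance : HasZeroObject (IndObj E κ) := ⟨⟨_, isZero_toInd (isZero_zero E)⟩⟩

theorem hasBinaryBiproducts_indObj : HasBinaryBiproducts (IndObj E κ) := by
  refine ⟨fun F G => ?_⟩
  have h := ind_conflation_zero_id G (isZero_zero (IndObj E κ))
  obtain ⟨K, φ, γ, β', hc, w, hβ⟩ := exists_ind_pushout h (0 : _ ⟶ F)
  have hp := isPushout_of_lexExact h hc w hβ
  have hz : φ ≫ β' = 0 := indHom_ext (conflation_ind_iff.1 hc).comp_eq_zero
  refine hasBinaryBiproduct_of_total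
    { pt := K
      fst := hp.desc 0 (𝟙 F) (by simp)
      snd := β'
      inl := φ
      inr := γ
      inl_snd := hz
      inr_snd := hβ } (hp.hom_ext ?_ ?_)
  · simp [reassoc_of% hβ]
  · simp [reassoc_of% hz]

instance : QuillenExact (IndObj E κ) where
  hasZeroObject := inferInstance
  hasBinaryBiproducts := hasBinaryBiproducts_indObj E κ
  isKernelCokernelPair h := isKernelCokernelPair_of_hom h
  of_iso a b c h₁ h₂ h := conflation_ind_iff.2 ((conflation_ind_iff.1 h).of_iso (indIso a)
    (indIso b) (indIso c) (congrArg (fun r => r.hom.hom) h₁) (congrArg (fun r => r.hom.hom) h₂))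
  admMono_id F := ⟨_, _, ind_conflation_id_zero F (isZero_zero _)⟩
  admEpi_id F := ⟨_, _, ind_conflation_zero_id F (isZero_zero _)⟩
  admMono_comp := by
    rintro F G H α α₂ ⟨Q, β, h⟩ ⟨R, β₂, h₂⟩
    obtain ⟨G', φ, γ, β', h', w, hβ⟩ := exists_ind_pushout h₂ β
    exact ⟨G', γ, conflation_ind_iff.2 ((conflation_ind_iff.1 h).comp_mono
      (conflation_ind_iff.1 h₂) (conflation_ind_iff.1 h') (congrArg (fun r => r.hom.hom) w)
      (congrArg (fun r => r.hom.hom) hβ))⟩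
  admEpi_comp := by
    rintro G H L β γ ⟨F, α, h⟩ ⟨K, k, h'⟩
    obtain ⟨F₁, b, α', β', hp, w, hα, hex, -⟩ := exists_ind_pullback h k
    exact ⟨F₁, b, conflation_ind_iff.2 ((conflation_ind_iff.1 h).comp_epi
      (conflation_ind_iff.1 h') (conflation_ind_iff.1 hp) (congrArg (fun r => r.hom.hom) w)
      (congrArg (fun r => r.hom.hom) hα) hex)⟩
  exists_pushout := by
    rintro F G F' α μ ⟨H, β, h⟩
    obtain ⟨G', φ, γ, β', h', w, hβ⟩ := exists_ind_pushout h μ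
    exact ⟨G', γ, φ, isPushout_of_lexExact h h' w hβ, H, β', h'⟩
  exists_pullback := by
    rintro G H H' β ν ⟨F, α, h⟩
    obtain ⟨K, b, α', β', h', -, -, -, hp⟩ := exists_ind_pullback h ν
    exact ⟨K, b, β', hp, F, α', h'⟩

variable {E κ}

end IndExact

/-! ### Quotients of nested subobjects with quotients that are unions of small objects -/

section Retract

variable {E : Type u} [Category.{v} E] [Preadditive E] [HasConflations E] [QuillenExact E]
  {V Q R : Eᵒᵖ ⥤ AddCommGrpCat.{v}}

theorem LexExact.exists_yo_lift {F G H : Eᵒᵖ ⥤ AddCommGrpCat.{v}} {α : F ⟶ G} {β : G ⟶ H}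
    (h : LexExact α β) {X : E} (hF : isLeftExact E F) (t : yo X ⟶ G) (ht : t ≫ β = 0) :
    ∃ s : yo X ⟶ F, s ≫ α = t := by
  obtain ⟨x, hx⟩ := h.exact (ap t (𝟙 X)) (by rw [← ap_comp, ht]; rfl)
  obtain ⟨s, hs⟩ := hF.exists_ap x
  exact ⟨s, hom_ext_ap (by rw [ap_comp, hs, res_id, hx])⟩

/-- If `L ⟶ A` is a morphism of representable subobjects of `V`, and the map from `A` to
`Q = V / L` factors through a representable subobject `c` of `Q`, then `A / L` is a retract of some
representable `T`, in such a way that the projection is detected by a morphism `T ⟶ c`. -/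
theorem exists_retract (hV : isLeftExact E V) (hQ : isLeftExact E Q) (hR : isLeftExact E R)
    {L A c : E} {l : yo L ⟶ V} {ρ : V ⟶ Q} (hL : LexExact l ρ) {α : yo A ⟶ V} {σ : V ⟶ R}
    (hA : LexExact α σ) {f : L ⟶ A} (hf : preadditiveYoneda.map f ≫ α = l) {q : yo c ⟶ Q}
    (hq : ∀ B : E, Function.Injective (ap q (A := B))) {a : A ⟶ c}
    (ha : preadditiveYoneda.map a ≫ q = α ≫ ρ)
    (hR' : ∀ (X : E) (x : Sec R X), ∃ (Y : E) (y : X ⟶ Y) (j : yo Y ⟶ R),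
      (∀ B : E, Function.Injective (ap j (A := B))) ∧ ap j y = x) :
    ∃ (U : Eᵒᵖ ⥤ AddCommGrpCat.{v}) (π : yo A ⟶ U) (T : E) (s : U ⟶ yo T) (t : T ⟶ c),
      LexExact (preadditiveYoneda.map f) π ∧
      ∀ (w : E) (p : T ⟶ w) (r : w ⟶ c), Epi p → p ≫ r = t →
        ∃ d : yo w ⟶ U, s ≫ preadditiveYoneda.map p ≫ d = 𝟙 U := by
  have hl (B : E) : Function.Injective (ap l (A := B)) := hL.injective B
  have hα (B : E) : Function.Injective (ap α (A := B)) := hA.injective B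
  have hfa : f ≫ a = 0 := yo_cancel hq (by
    rw [Functor.map_comp_assoc, ha, reassoc_of% hf, hL.comp_eq_zero, Functor.map_zero, zero_comp])
  -- With `Q` as V/L and `R` as V/A, `ρ'` is the projection between them; its kernel will be U =
  -- A/L.
  obtain ⟨ρ', hρ'⟩ := hL.locSurj.exists_desc hQ hR σ fun B n hn => by
    obtain ⟨x, rfl⟩ := hL.exact n hn
    rw [← hf, ev_comp, hA.zero]
  let S (B : E) : AddSubgroup (Sec Q B) := (ev ρ').ker
  have hS {B B' : E} (g : B' ⟶ B) (x : Sec Q B) (hx : x ∈ S B) : res g x ∈ S B' := by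
    change ev ρ' _ = 0
    rw [ev_res, show ev ρ' x = 0 from hx, map_zero]
  let i := subPshι S hS
  have hi (B : E) : Function.Injective (ev i (A := B)) := subPshι_injective B
  have hU : isLeftExact E (subPsh S hS) := isLeftExact_subPsh hQ fun p x hp hx =>
    hR.eq_of_res hp (by rw [← ev_res, show ev ρ' _ = 0 from hx, map_zero])
  have lift {X : Eᵒᵖ ⥤ AddCommGrpCat.{v}} (μ : X ⟶ Q) (hμ : μ ≫ ρ' = 0) :
      ∃ m : X ⟶ subPsh S hS, m ≫ i = μ :=
    exists_lift_of_mem_range hi μ fun B x => exists_subPshι (hS := hS)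
      (show ev ρ' (ev μ x) = 0 by rw [← ev_comp, hμ, ev_zero])
  obtain ⟨π, hπ⟩ := lift (α ≫ ρ) (by rw [Category.assoc, hρ', hA.comp_eq_zero])
  have hπ' {B : E} (x : B ⟶ A) : ev i (ap π x) = ev ρ (ap α x) := by
    rw [← ap_comp, hπ, ap_comp]
  have hfπ : LexExact (preadditiveYoneda.map f) π := by
    refine ⟨fun B x y hxy => ?_, fun {B} x => ?_, fun {B} y hy => ?_, fun B z => ?_⟩
    · change B ⟶ L at x y
      refine hl B ?_
      rw [← hf, ap_map, ap_map]
      exact congrArg (ap α) hxy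
    · change B ⟶ L at x
      refine hi B ?_
      change ev i (ap π (x ≫ f)) = _
      rw [hπ', ← ap_map, hf, map_zero]
      exact hL.zero _
    · change B ⟶ A at y
      obtain ⟨x, hx⟩ := hL.exact (ap α y) (by rw [← hπ', show ap π y = 0 from hy, map_zero])
      refine ⟨x, hα B ?_⟩
      rw [← hx, ← hf]
      rfl
    · obtain ⟨B', p, v, hp, hv⟩ := hL.locSurj B (ev i z)
      obtain ⟨y, hy⟩ := hA.exact v (by
        rw [← hρ', ev_comp, hv, ev_res, show ev ρ' (ev i z) = 0 from subPshι_mem z, map_zero])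
      exact ⟨B', p, y, hp, hi _ (by rw [ev_res, ← hv, ← hy]; exact hπ' _)⟩
  -- The preimage B of `c` in `V` is obtained by gluing `L` to a cover `W` of `c` along the kernel
  -- `K`; `ω` is the map of `W` to `V`.
  obtain ⟨W, p, v, ⟨K, k, hk⟩, hv⟩ := hL.locSurj c (ap q (𝟙 c))
  obtain ⟨ω, hω⟩ := hV.exists_ap v
  have hωρ : ω ≫ ρ = preadditiveYoneda.map p ≫ q := hom_ext_ap (by
    rw [ap_comp, hω, res_id, hv, res_ap, ap_map, Category.comp_id, Category.id_comp])
  have yL := isLeftExact_preadditiveYoneda E L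
  obtain ⟨m', hm⟩ := hL.exists_yo_lift yL (preadditiveYoneda.map k ≫ ω) (by
    rw [Category.assoc, hωρ, ← Functor.map_comp_assoc, hk.zero, Functor.map_zero, zero_comp])
  obtain ⟨m, rfl⟩ := exists_yo_map m'
  -- `T` is A ⊔_L B, obtained in one pushout along `K ⟶ L ⟶ A`. Below, `t` is `a` on `A` and zero on
  -- `W`, hence zero on B because `f ≫ a = 0`.
  obtain ⟨T, iW, iA, g, hT, hc, hg⟩ := hk.exists_pushout (m ≫ f)
  let t : T ⟶ c := hT.desc 0 a (by rw [comp_zero, Category.assoc, hfa, comp_zero])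
  have htA : iA ≫ t = a := hT.inr_desc _ _ _
  have htW : iW ≫ t = 0 := hT.inl_desc _ _ _
  -- `N` is the fibre product of `A` and `W` over `c`, which covers `A`. The two resulting maps to
  -- `V` agree modulo `L`, and `n` is their difference.
  obtain ⟨N, nW, kN, nA, hN, hcN, hkN⟩ := hk.exists_pullback a
  obtain ⟨n', hn⟩ := hL.exists_yo_lift yL
    (preadditiveYoneda.map nA ≫ α - preadditiveYoneda.map nW ≫ ω) (by
      rw [Preadditive.sub_comp, Category.assoc, Category.assoc, ← ha, hωρ,
        ← Functor.map_comp_assoc, ← Functor.map_comp_assoc, hN.w, sub_self])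
  obtain ⟨n, rfl⟩ := exists_yo_map n'
  -- The antidiagonal x ↦ (x, -x) of `A`, with the second copy of x written in B as `n` plus the
  -- component in `W`, and `n` moved over to `A`. It vanishes on `L`, so it descends to `s` on U.
  let φ : N ⟶ T := (nA - n ≫ f) ≫ iA - nW ≫ iW
  have hNU : LocSurj (preadditiveYoneda.map nA ≫ π) :=
    (LexExact.of_conflation hcN).locSurj.comp hfπ.locSurj
  obtain ⟨s, hs⟩ := hNU.exists_desc hU (isLeftExact_preadditiveYoneda E T)
    (preadditiveYoneda.map φ) fun B x hx => by
      change B ⟶ N at x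
      change x ≫ φ = 0
      obtain ⟨y, hy⟩ := hfπ.exact (x ≫ nA : B ⟶ A) hx
      change B ⟶ L at y
      change y ≫ f = x ≫ nA at hy
      obtain ⟨z, hz⟩ := hk.lift (x ≫ nW) (by
        rw [Category.assoc, hN.w, ← Category.assoc, ← hy, Category.assoc, hfa, comp_zero])
      have hxn : x ≫ n = y - z ≫ m := hl B (by
        have h1 : ap l y = ap α (x ≫ nA) := by rw [← hf, ap_map, hy]
        have h2 : ap l (z ≫ m) = ap ω (x ≫ nW) := by rw [← ap_map, hm, ap_map, hz]
        rw [← ap_map, hn, map_sub, h1, h2]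
        rfl)
      simp only [φ, Preadditive.comp_sub, Preadditive.sub_comp, ← Category.assoc, hxn, ← hy, ← hz,
        sub_sub_cancel]
      simp only [Category.assoc, hT.w, sub_self]
  have hφt : φ ≫ t = nA ≫ a := by
    simp only [φ, Preadditive.sub_comp, Category.assoc, htA, htW, hfa, comp_zero, sub_zero]
  refine ⟨subPsh S hS, π, T, s, t, hfπ, fun w p' r hp' hpr => ?_⟩
  -- `p'` is epic in `E` only, which says nothing about maps to arbitrary presheaves. The map from
  -- `w` to `R` passes through a representable subobject of `R`, and there `p'` can be cancelled.
  obtain ⟨d, hd⟩ := lift (preadditiveYoneda.map r ≫ q) (by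
    obtain ⟨Y, y, j, hj, hy⟩ := hR' w (ap (preadditiveYoneda.map r ≫ q ≫ ρ') (𝟙 w))
    have e : preadditiveYoneda.map y ≫ j = preadditiveYoneda.map r ≫ q ≫ ρ' :=
      hom_ext_ap (by rw [← hy, ap_map, Category.id_comp])
    have hpy : p' ≫ y = 0 := by
      apply hT.hom_ext
      · rw [comp_zero]
        refine yo_cancel hj ?_
        rw [Functor.map_comp_assoc, Functor.map_comp_assoc, e, ← Functor.map_comp_assoc,
          ← Functor.map_comp_assoc, Category.assoc, hpr, htW, Functor.map_zero, zero_comp,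
          Functor.map_zero, zero_comp]
      · rw [comp_zero]
        refine yo_cancel hj ?_
        rw [Functor.map_comp_assoc, Functor.map_comp_assoc, e, ← Functor.map_comp_assoc,
          ← Functor.map_comp_assoc, Category.assoc, hpr, htA, reassoc_of% ha, hρ',
          hA.comp_eq_zero, Functor.map_zero, zero_comp]
    have hy0 : y = 0 := by rw [← cancel_epi p', hpy, comp_zero]
    rw [Category.assoc, ← e, hy0, Functor.map_zero, zero_comp])
  refine ⟨d, hNU.hom_ext hU ?_⟩
  rw [← Category.assoc, hs, Category.comp_id]
  refine hom_ext_ev fun B x => hi B ?_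
  rw [← ev_comp, ← ev_comp]
  congr 1
  rw [Category.assoc, Category.assoc, hd, ← Functor.map_comp_assoc, ← Functor.map_comp_assoc,
    Category.assoc, hpr, hφt, Functor.map_comp_assoc, ha, Category.assoc, hπ]

end Retract

/-! ### The embedding of `D` into admissible Pro objects -/

section Pro

variable {D : Type u} [Category.{v} D] [Preadditive D] [HasConflations D] [QuillenExact D]
  {κ : Cardinal.{v}} [Fact (Cardinal.aleph0 ≤ κ)]

/-- Reflection of conflations, applied in the opposite category, lets a conflation of Pro objects
whose terms come from `D` be read in `D`. -/
theorem toPro_conflation_iff {X Y Z : D} {f : X ⟶ Y} {g : Y ⟶ Z} :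
    Conflation ((toPro D κ).map f) ((toPro D κ).map g) ↔ Conflation f g := by
  have h : Conflation ((toPro D κ).map f) ((toPro D κ).map g) ↔
      LexExact (preadditiveYoneda.map g.op) (preadditiveYoneda.map f.op) :=
    conflation_ind_iff (F := (toInd Dᵒᵖ κ).obj (op Z)) (G := (toInd Dᵒᵖ κ).obj (op Y))
      (H := (toInd Dᵒᵖ κ).obj (op X)) (α := (toInd Dᵒᵖ κ).map g.op) (β := (toInd Dᵒᵖ κ).map f.op)
  rw [h]
  exact ⟨fun h => (conflation_of_lexExact h : Conflation g.op f.op),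
    fun h => LexExact.of_conflation h.op⟩

theorem exists_toPro_map {X Y : D} (m : (toPro D κ).obj X ⟶ (toPro D κ).obj Y) :
    ∃ f : X ⟶ Y, (toPro D κ).map f = m := by
  obtain ⟨a, ha⟩ := exists_yo_map (X := op Y) (Y := op X) m.unop.hom.hom
  exact ⟨a.unop, Quiver.Hom.unop_inj (indHom_ext ha)⟩

theorem toPro_map_injective {X Y : D} {f g : X ⟶ Y}
    (h : (toPro D κ).map f = (toPro D κ).map g) : f = g := by
  have : preadditiveYoneda.map f.op = preadditiveYoneda.map g.op :=
    congrArg (fun r => r.unop.hom.hom) h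
  exact Quiver.Hom.op_inj (yo_map_eq_iff.1 this)

/-- A morphism from an admissible Pro object to an object of `D` factors through an epic onto an
object of `D`. -/
theorem exists_toPro_factorization {T : ProObj D κ} {c : D} (t : T ⟶ (toPro D κ).obj c) :
    ∃ (w : D) (p : T ⟶ (toPro D κ).obj w) (r : w ⟶ c), Epi p ∧ p ≫ (toPro D κ).map r = t := by
  obtain ⟨S⟩ := ind_pres T.unop
  -- In the opposite category this is a map from a representable to a union: it factors through a
  -- piece, and the inclusion of the piece is monic.
  obtain ⟨i, f, hf⟩ := S.isUnion.exists_ap _ (ap (Y := op c) t.unop.hom.hom (𝟙 (op c)))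
  let m : (toInd Dᵒᵖ κ).obj (S.X.obj i) ⟶ T.unop := indHom (S.ι i)
  have : Mono m := ⟨fun a b hab => indHom_ext (hom_ext_ev fun A x => S.isUnion.injective i A
    (congrArg (fun r : _ ⟶ T.unop => ev r.hom.hom x) hab))⟩
  refine ⟨(S.X.obj i).unop, m.op, f.unop, inferInstanceAs (Epi m.op), Quiver.Hom.unop_inj
    (indHom_ext (hom_ext_ap ?_))⟩
  change ap (preadditiveYoneda.map f ≫ S.ι i) (𝟙 _) = _
  rw [ap_map, Category.id_comp, hf]
  rfl

end Pro

/-! ### Morphisms between relative lattices. -/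

section Tate

variable {D : Type u} [Category.{v} D] [Preadditive D] [HasConflations D] [QuillenExact D]
  {κ : Cardinal.{v}} [hκ : Fact (Cardinal.aleph0 ≤ κ)] {C : ObjectProperty D}

instance : Fact (Cardinal.aleph0 ≤ Cardinal.lift.{u} κ) := ⟨by simpa using hκ.out⟩

/-- A morphism of relative elementary Tate objects from a morphism of presheaves. -/
def elHom {X Y : ElTate κ C} (α : X.presheaf ⟶ Y.presheaf) : X ⟶ Y :=
  ObjectProperty.homMk (ObjectProperty.homMk (ObjectProperty.homMk α))

/-- The morphism of presheaves that underlies a morphism of relative elementary Tate objects. -/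
abbrev elPsh {X Y : ElTate κ C} (α : X ⟶ Y) : X.presheaf ⟶ Y.presheaf := α.hom.hom.hom

theorem elHom_ext {X Y : ElTate κ C} {α β : X ⟶ Y} (h : elPsh α = elPsh β) : α = β :=
  ObjectProperty.hom_ext _ (ObjectProperty.hom_ext _ (ObjectProperty.hom_ext _ h))

theorem conflation_el_iff {X Y Z : ElTate κ C} {α : X ⟶ Y} {β : Y ⟶ Z} :
    Conflation α β ↔ LexExact (elPsh α) (elPsh β) :=
  conflation_lex_iff (E := ProObj D κ)

theorem ElTate.isLeftExact (X : ElTate κ C) : isLeftExact (ProObj D κ) X.presheaf :=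
  X.obj.obj.property

/-- The isomorphism of presheaves underlying an isomorphism of relative elementary Tate objects. -/
def elIso {X Y : ElTate κ C} (e : X ≅ Y) : X.presheaf ≅ Y.presheaf where
  hom := elPsh e.hom
  inv := elPsh e.inv
  hom_inv_id := congrArg elPsh e.hom_inv_id
  inv_hom_id := congrArg elPsh e.inv_hom_id

variable (κ C)

/-- The relative elementary Tate object of an admissible Pro object. -/
def elRep (P : ProObj D κ) : ElTate κ C :=
  ⟨(toInd (ProObj D κ) (Cardinal.lift.{u} κ)).obj P, by
    let S : AdmIndDiagram (ProObj D κ) (Cardinal.lift.{u} κ) :=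
      { I := PUnit
        card_le := by
          rw [Cardinal.mk_fintype, Fintype.card_punit, Nat.cast_one]
          exact Cardinal.one_le_aleph0.trans
            (Fact.out : Cardinal.aleph0 ≤ Cardinal.lift.{u} κ)
        X := (Functor.const _).obj P
        admMono := fun _ => AdmMono.id P }
    have hS : IsUnion S.X (F := yo P) (fun _ => 𝟙 (yo P)) :=
      ⟨fun _ => (Category.comp_id _).trans (preadditiveYoneda.map_id P), fun _ _ _ _ h => h,
        fun A x => ⟨PUnit.unit, x, rfl⟩⟩
    exact ⟨S, hS.isColimitOf, fun i j h => (lt_irrefl _ h).elim⟩⟩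

variable {κ C}

theorem elRep_isPro (P : ProObj D κ) : (elRep κ C P).IsPro := ⟨P, ⟨Iso.refl _⟩⟩

theorem IsRelLattice.of_iso {L L' V : ElTate κ C} {i : L ⟶ V} (h : IsRelLattice i) (e : L' ≅ L) :
    IsRelLattice (e.hom ≫ i) := by
  obtain ⟨⟨P, ⟨a⟩⟩, Q, q, hc, hQ⟩ := h
  refine ⟨⟨P, ⟨a ≪≫ (elIso e).symm⟩⟩, Q, q, ?_, hQ⟩
  refine conflation_el_iff.2 ((conflation_el_iff.1 hc).of_iso (elIso e).symm (Iso.refl _)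
    (Iso.refl _) ?_ ?_)
  · simp [elIso, ← Category.assoc, ← ObjectProperty.FullSubcategory.comp_hom]
  · simp

theorem IsRelLattice.mono {L V : ElTate κ C} {i : L ⟶ V} (h : IsRelLattice i) : Mono i := by
  obtain ⟨-, Q, q, hc, -⟩ := h
  exact ⟨fun a b hab => elHom_ext (hom_ext_ev fun A x => (conflation_el_iff.1 hc).injective A
    (congrArg (fun r => ev (elPsh r) x) hab))⟩

theorem toPro_mono {X Y : D} {f : X ⟶ Y} (h : AdmMono f) : Mono ((toPro D κ).map f) := by
  obtain ⟨Z, g, h⟩ := h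
  exact (toPro_conflation_iff.2 h).mono

/-- An object of `Ind C` is the union of representables of objects of `C`. -/
theorem ElTate.IsIndSub.exists_isUnion {Q : ElTate κ C} (h : Q.IsIndSub) :
    ∃ (S : AdmIndDiagram C.FullSubcategory κ)
      (ι : ∀ i, yo ((S.X ⋙ C.ι ⋙ toPro D κ).obj i) ⟶ Q.presheaf),
      IsUnion (S.X ⋙ C.ι ⋙ toPro D κ) ι := by
  obtain ⟨S, hS⟩ := h
  -- The index set lives in `Type v` while the sections live in `Type (max u v)`, so preservation of
  -- filtered colimits has to be resized.
  have : PreservesFilteredColimitsOfSize.{v, v} (forget AddCommGrpCat.{max u v}) :=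
    preservesFilteredColimitsOfSize_shrink.{v, u, v, u} _
  have := PreservesFilteredColimitsOfSize.preserves_filtered_colimits
    (F := forget AddCommGrpCat.{max u v}) S.I
  refine ⟨S, IsUnion.of_isColimitOf (fun {i j} a => ?_) hS⟩
  obtain ⟨Z, g, hg⟩ := S.admMono a
  exact toPro_mono ⟨_, _, hg⟩

/-- A morphism of relative lattices is an admissible monic if `D` is idempotent complete. -/
theorem admMono_of_isRelLattice [IsIdempotentComplete D] {L A V : ElTate κ C} {i : L ⟶ V}
    {j : A ⟶ V} (hi : IsRelLattice i) (hj : IsRelLattice j) (f : L ⟶ A) (hf : f ≫ j = i) :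
    AdmMono f := by
  obtain ⟨⟨P, ⟨a⟩⟩, Q, ρ, hL, hQ⟩ := hi
  obtain ⟨⟨P', ⟨a'⟩⟩, R, σ, hA, hR⟩ := hj
  obtain ⟨S, ι, hι⟩ := hQ.exists_isUnion
  obtain ⟨S', ι', hι'⟩ := hR.exists_isUnion
  obtain ⟨f₀, hf₀⟩ := exists_yo_map (a.hom ≫ elPsh f ≫ a'.inv)
  have hL' : LexExact (a.hom ≫ elPsh i) (elPsh ρ) := (conflation_el_iff.1 hL).of_iso a.symm
    (Iso.refl _) (Iso.refl _) (by simp) (by simp)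
  have hA' : LexExact (a'.hom ≫ elPsh j) (elPsh σ) := (conflation_el_iff.1 hA).of_iso a'.symm
    (Iso.refl _) (Iso.refl _) (by simp) (by simp)
  have hfj : elPsh f ≫ elPsh j = elPsh i := congrArg elPsh hf
  have hfα : preadditiveYoneda.map f₀ ≫ a'.hom ≫ elPsh j = a.hom ≫ elPsh i := by
    rw [hf₀, Category.assoc, Category.assoc, a'.inv_hom_id_assoc, hfj]
  -- `A` is representable, so its map to the Ind object V/L lands in one piece, an object of `C`.
  obtain ⟨k, x, hx⟩ := hι.exists_ap P' (ap ((a'.hom ≫ elPsh j) ≫ elPsh ρ) (𝟙 P'))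
  obtain ⟨U, π, T, s, t, hU, hret⟩ := exists_retract V.isLeftExact Q.isLeftExact R.isLeftExact hL'
    hA' hfα (hι.injective k) (a := x) (hom_ext_ap (by rw [ap_map, Category.id_comp, hx]))
    fun X y => by
      obtain ⟨i, z, hz⟩ := hι'.exists_ap X y
      exact ⟨_, z, ι' i, hι'.injective i, hz⟩
  obtain ⟨w, p, r, hp, hpr⟩ := exists_toPro_factorization (T := T) (c := (S.X.obj k).obj) t
  obtain ⟨d, hd⟩ := hret _ p _ hp hpr
  -- The retraction of `w` onto U gives an idempotent of `w` with image U. It comes from `D` by full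
  -- faithfulness, and splitting it there makes U representable.
  obtain ⟨e', he'⟩ := exists_yo_map (d ≫ s ≫ preadditiveYoneda.map p)
  obtain ⟨e, rfl⟩ := exists_toPro_map e'
  have he : e ≫ e = e := toPro_map_injective (κ := κ) (yo_map_eq_iff.1 (by
    rw [Functor.map_comp, Functor.map_comp, he']
    simp only [Category.assoc]
    rw [reassoc_of% hd]))
  obtain ⟨u, m, q, hmq, hqm⟩ := IsIdempotentComplete.idempotents_split w e he
  have e₁ : preadditiveYoneda.map ((toPro D κ).map q) ≫ preadditiveYoneda.map ((toPro D κ).map m) =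
      d ≫ s ≫ preadditiveYoneda.map p := by
    rw [← Functor.map_comp, ← Functor.map_comp, hqm, he']
  have e₂ : preadditiveYoneda.map ((toPro D κ).map m) ≫ preadditiveYoneda.map ((toPro D κ).map q) =
      𝟙 _ := by
    rw [← Functor.map_comp, ← Functor.map_comp, hmq, CategoryTheory.Functor.map_id,
      CategoryTheory.Functor.map_id]
  let b : U ≅ yo ((toPro D κ).obj u) :=
    { hom := (s ≫ preadditiveYoneda.map p) ≫ preadditiveYoneda.map ((toPro D κ).map q)
      inv := preadditiveYoneda.map ((toPro D κ).map m) ≫ d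
      hom_inv_id := by
        simp only [Category.assoc]
        rw [reassoc_of% e₁, hd, Category.comp_id, hd]
      inv_hom_id := by
        simp only [Category.assoc]
        have := congrArg (· ≫ preadditiveYoneda.map ((toPro D κ).map q)) e₁
        simp only [Category.assoc] at this
        rw [← this, reassoc_of% e₂, e₂] }
  refine ⟨elRep κ C ((toPro D κ).obj u), elHom (a'.inv ≫ π ≫ b.hom), conflation_el_iff.2
    (hU.of_iso a a' b ?_ ?_)⟩
  · rw [hf₀, Category.assoc, Category.assoc, a'.inv_hom_id, Category.comp_id]
  · change _ = a'.hom ≫ a'.inv ≫ π ≫ b.hom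
    exact (a'.hom_inv_id_assoc _).symm

end Tate

/-! ### The quotient of a union by one of its pieces. -/

section QuotientDiagram

variable {E : Type u} [Category.{v} E] [Preadditive E] [HasConflations E] [QuillenExact E]
  {I : Type v} [PartialOrder I] [IsDirectedOrder I]

/-- The quotient of a union by one of its pieces is the union of the quotients. -/
theorem exists_quotient_union {F : Eᵒᵖ ⥤ AddCommGrpCat.{v}} {X : I ⥤ E}
    (hX : ∀ {i j : I} (a : i ⟶ j), AdmMono (X.map a)) {ι : ∀ i, yo (X.obj i) ⟶ F}
    (hι : IsUnion X ι) (i₀ : I) :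
    ∃ (Z : Set.Ici i₀ ⥤ E) (g : ∀ j : Set.Ici i₀, X.obj j ⟶ Z.obj j)
      (G : Eᵒᵖ ⥤ AddCommGrpCat.{v}) (ζ : ∀ j, yo (Z.obj j) ⟶ G) (ρ : F ⟶ G),
      IsUnion Z ζ ∧ LexExact (ι i₀) ρ ∧
      (∀ j : Set.Ici i₀, Conflation (X.map (homOfLE j.2)) (g j)) ∧
      ∀ (i j : Set.Ici i₀) (h : i ≤ j) (Q : E) (q : X.obj j ⟶ Q),
        Conflation (X.map (homOfLE h : i.1 ⟶ j.1)) q →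
          ∃ d : Z.obj j ⟶ Q, Conflation (Z.map (homOfLE h)) d := by
  choose Z g hg using fun j : Set.Ici i₀ => hX (homOfLE j.2)
  have hXX {i j : Set.Ici i₀} (a : i ≤ j) :
      X.map (homOfLE i.2) ≫ X.map (homOfLE a : i.1 ⟶ j.1) = X.map (homOfLE j.2) :=
    (X.map_comp _ _).symm
  have hT (i j : Set.Ici i₀) (a : i ≤ j) :
      ∃ t : Z i ⟶ Z j, g i ≫ t = X.map (homOfLE a : i.1 ⟶ j.1) ≫ g j :=
    (hg i).desc _ (by rw [reassoc_of% (hXX a), (hg j).zero])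
  choose T hT using hT
  let ZF : Set.Ici i₀ ⥤ E :=
    { obj := Z
      map := fun {i j} a => T i j (leOfHom a)
      map_id := fun i => by
        have := (hg i).epi
        rw [← cancel_epi (g i), hT, Category.comp_id]
        exact (congrArg (· ≫ g i) (X.map_id _)).trans (Category.id_comp _)
      map_comp := fun {i j k} a b => by
        have := (hg i).epi
        rw [← cancel_epi (g i), hT, reassoc_of% (hT i j (leOfHom a)), hT, ← Category.assoc,
          ← Functor.map_comp, homOfLE_comp] }
  have hq (i j : Set.Ici i₀) (h : i ≤ j) (Q : E) (q : X.obj j ⟶ Q)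
      (hc : Conflation (X.map (homOfLE h : i.1 ⟶ j.1)) q) :
      ∃ d : Z j ⟶ Q, Conflation (T i j h) d := by
    obtain ⟨d, hd⟩ := (hg j).desc q (by rw [← hXX h, Category.assoc, hc.zero, comp_zero])
    -- By Noether's isomorphism, the successive quotients of the new diagram are those of the old
    -- one.
    exact ⟨d, (hg i).quotient (by rw [hXX h]; exact hg j) hc (hT i j h) hd⟩
  have hZ {i j : Set.Ici i₀} (a : i ⟶ j) : AdmMono (ZF.map a) := by
    obtain ⟨Q, q, hc⟩ := hX (homOfLE (leOfHom a) : i.1 ⟶ j.1)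
    obtain ⟨d, hd⟩ := hq i j (leOfHom a) Q q hc
    exact ⟨Q, d, hd⟩
  have dir : IsDirectedOrder (Set.Ici i₀) := ⟨fun i j => by
    obtain ⟨k, hik, hjk⟩ := exists_ge_ge i.1 j.1
    exact ⟨⟨k, i.2.trans hik⟩, hik, hjk⟩⟩
  obtain ⟨G, ζ, hζ⟩ := IsUnion.exists_isUnion ZF fun a => (hZ a).mono
  have hc (i : I) : ∃ j : Set.Ici i₀, i ≤ j.1 := by
    obtain ⟨k, hik, hk⟩ := exists_ge_ge i i₀
    exact ⟨⟨k, hk⟩, hik⟩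
  obtain ⟨ρ, hρ⟩ := hι.exists_desc_cofinal (J := Set.Ici i₀) (φ := Subtype.val) (T := G)
    (fun _ _ h => h) hc (fun j => preadditiveYoneda.map (g j) ≫ ζ j) fun {i j} a => by
      rw [← hζ.comp (homOfLE a), ← Functor.map_comp_assoc, ← Functor.map_comp_assoc]
      congr 2
      exact (hT i j a).symm
  have hρ' (j : Set.Ici i₀) {A : E} (x : A ⟶ X.obj j.1) :
      ev ρ (ap (ι j.1) x) = ap (ζ j) (x ≫ g j) := by
    rw [← ap_comp, hρ]; rfl
  refine ⟨ZF, g, G, ζ, ρ, hζ, ⟨hι.injective i₀, fun {A} x => ?_, fun {A} y hy => ?_, fun A z => ?_⟩,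
    hg, hq⟩
  · have := (hρ' ⟨i₀, le_rfl⟩ x).trans (congrArg (ap _) (?_ : _ = (0 : A ⟶ _)))
    · exact this.trans (map_zero _)
    · have h0 := (hg ⟨i₀, le_rfl⟩).zero
      rw [show (homOfLE le_rfl : i₀ ⟶ i₀) = 𝟙 i₀ from rfl, CategoryTheory.Functor.map_id,
        Category.id_comp] at h0
      exact (congrArg (fun t => x ≫ t) h0).trans comp_zero
  · obtain ⟨j, x, rfl⟩ := hι.exists_ap_cofinal (φ := Subtype.val) hc A y
    rw [hρ'] at hy
    obtain ⟨s, rfl⟩ := (hg j).lift x (hζ.injective j A (hy.trans (map_zero _).symm))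
    exact ⟨s, (hι.ap_map (homOfLE j.2) s).symm⟩
  · obtain ⟨j, x, rfl⟩ := hζ.exists_ap A z
    obtain ⟨B, p, t, hp, ht⟩ := AdmEpi.exists_lift ⟨_, _, hg j⟩ x
    exact ⟨B, p, ap (ι j.1) t, hp, by rw [hρ', ht, res_ap]⟩

end QuotientDiagram

/-! ### Pieces as lattices, and the order on lattices. -/

section Tate

variable {D : Type u} [Category.{v} D] [Preadditive D] [HasConflations D] [QuillenExact D]
  {κ : Cardinal.{v}} [hκ : Fact (Cardinal.aleph0 ≤ κ)] {C : ObjectProperty D}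

/-- A small union of objects of `C` along monics with quotients in `C` is in `Ind C`. -/
theorem isIndSub_of_isUnion (hC : IsExtensionClosed C) {Q : ElTate κ C} {J : Type (max u v)}
    [PartialOrder J] [IsDirectedOrder J] [Nonempty J] (hJ : Cardinal.mk J ≤ Cardinal.lift.{u} κ)
    {Z : J ⥤ ProObj D κ} {ζ : ∀ j, yo (Z.obj j) ⟶ Q.presheaf} (hζ : IsUnion Z ζ)
    (hZ : ∀ j, C.map (toPro D κ) (Z.obj j))
    (hZ' : ∀ (i j : J) (h : i < j), ∃ (P : ProObj D κ) (d : Z.obj j ⟶ P),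
      Conflation (Z.map (homOfLE h.le)) d ∧ C.map (toPro D κ) P) : Q.IsIndSub := by
  choose c hc e using fun j => (C.prop_map_iff (toPro D κ) _).1 (hZ j)
  replace e (j : J) := (e j).some
  choose T hT using fun (i j : J) (h : i ≤ j) =>
    exists_toPro_map ((e i).hom ≫ Z.map (homOfLE h) ≫ (e j).inv)
  let X : J ⥤ C.FullSubcategory :=
    { obj := fun j => ⟨c j, hc j⟩
      map := fun {i j} a => ObjectProperty.homMk (T i j (leOfHom a))
      map_id := fun i => ObjectProperty.hom_ext _ (toPro_map_injective (κ := κ) (by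
        change (toPro D κ).map (T i i _) = (toPro D κ).map (𝟙 (c i))
        rw [hT, CategoryTheory.Functor.map_id, show (homOfLE (le_refl i)) = 𝟙 i from rfl,
          CategoryTheory.Functor.map_id, Category.id_comp, Iso.hom_inv_id]))
      map_comp := fun {i j k} a b => ObjectProperty.hom_ext _ (toPro_map_injective (κ := κ) (by
        change (toPro D κ).map (T i k _) = (toPro D κ).map (T i j _ ≫ T j k _)
        rw [Functor.map_comp, hT, hT, hT]
        simp only [Category.assoc, Iso.inv_hom_id_assoc]
        rw [← Functor.map_comp_assoc, homOfLE_comp])) }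
  have hX {i j : J} (a : i ⟶ j) : AdmMono (X.map a) := by
    -- Quotients in `C` are supplied for strict inequalities only; for equal indices the quotient is
    -- zero.
    obtain rfl | hij := (leOfHom a).eq_or_lt
    · have ha : X.map a = 𝟙 _ := by
        rw [show a = 𝟙 i from rfl, CategoryTheory.Functor.map_id]
      obtain ⟨O, hO⟩ := HasZeroObject.zero (C := D)
      rw [ha]
      exact ⟨⟨O, hC.zero O hO⟩, ObjectProperty.homMk 0, Conflation.id_zero hO (c i)⟩
    · obtain ⟨P, d, hd, hP⟩ := hZ' i j hij
      obtain ⟨p, hp, ⟨b⟩⟩ := (C.prop_map_iff (toPro D κ) _).1 hP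
      obtain ⟨g, hg⟩ := exists_toPro_map ((e j).hom ≫ d ≫ b.inv)
      have h : Conflation ((toPro D κ).map (T i j hij.le)) ((toPro D κ).map g) :=
        QuillenExact.of_iso (e i).symm (e j).symm b.symm (by rw [hT]; simp) (by rw [hg]; simp) hd
      have h' : Conflation (T i j hij.le) g := (toPro_conflation_iff (κ := κ)).1 h
      exact ⟨⟨p, hp⟩, ObjectProperty.homMk g, h'⟩
  have hu : IsUnion (X ⋙ C.ι ⋙ toPro D κ)
      (fun j => preadditiveYoneda.map (e j).hom ≫ ζ j) := by
    refine ⟨fun {i j} a => ?_, fun j A => ?_, fun A x => ?_⟩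
    · change preadditiveYoneda.map ((toPro D κ).map (T i j (leOfHom a))) ≫
        preadditiveYoneda.map (e j).hom ≫ ζ j = _
      rw [hT, ← Functor.map_comp_assoc, Category.assoc, Category.assoc, Iso.inv_hom_id,
        Category.comp_id, Functor.map_comp_assoc, hζ.comp]
    · intro f g hfg
      exact (cancel_mono (e j).hom).1 (hζ.injective j A hfg)
    · obtain ⟨j, f, rfl⟩ := hζ.exists_ap A x
      refine ⟨j, f ≫ (e j).inv, (ap_map _ _ _).trans ?_⟩
      rw [Category.assoc, Iso.inv_hom_id, Category.comp_id]
  -- Ind objects of `C` are indexed in `Type v`, while `J` is larger in universe. The cardinality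
  -- bound provides a copy of `J` there, and the order is transported to it.
  obtain ⟨α, hα⟩ := Cardinal.mem_range_lift_of_le hJ
  obtain ⟨J', rfl⟩ : ∃ J' : Type v, Cardinal.mk J' = α := ⟨_, Cardinal.mk_out α⟩
  rw [← Cardinal.mk_uLift] at hα
  obtain ⟨ε⟩ := Cardinal.eq.1 hα
  let f : J' ≃ J := Equiv.ulift.symm.trans ε
  let _ : PartialOrder J' := PartialOrder.lift f f.injective
  have dir : IsDirectedOrder J' := ⟨fun i j => by
    obtain ⟨k, hik, hjk⟩ := exists_ge_ge (f i) (f j)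
    exact ⟨f.symm k, by change f i ≤ f (f.symm k); simpa using hik,
      by change f j ≤ f (f.symm k); simpa using hjk⟩⟩
  have ne : Nonempty J' := f.nonempty
  have hf : Monotone f := fun _ _ h => h
  refine ⟨{ I := J'
            card_le := ?_
            X := hf.functor ⋙ X
            admMono := fun a => hX (hf.functor.map a) }, ?_⟩
  · rw [← Cardinal.lift_le.{u}, ← Cardinal.mk_uLift, hα]
    exact hJ
  · exact (hu.restrict hf.functor fun j => ⟨f.symm j, (f.apply_symm_apply j).ge⟩).isColimitOf

/-- The pieces of a relative elementary Tate object are relative lattices. -/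
theorem exists_lattice_diagram (hC : IsExtensionClosed C) (V : ElTate κ C) :
    ∃ (S : AdmIndDiagram (ProObj D κ) (Cardinal.lift.{u} κ)) (ι : ∀ i, yo (S.X.obj i) ⟶ V.presheaf),
      IsUnion S.X ι ∧ ∀ i, IsRelLattice (elHom (ι i) : elRep κ C (S.X.obj i) ⟶ V) := by
  obtain ⟨S, hS, hq⟩ := V.property
  obtain ⟨ι, hι⟩ := IsUnion.of_isColimitOf (fun a => (S.admMono a).mono) hS
  refine ⟨S, ι, hι, fun i₀ => ⟨elRep_isPro _, ?_⟩⟩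
  obtain ⟨Z, g, G, ζ, ρ, hζ, hρ, hg, hquot⟩ := exists_quotient_union S.admMono hι i₀
  have dir : IsDirectedOrder (Set.Ici i₀) := ⟨fun i j => by
    obtain ⟨k, hik, hjk⟩ := exists_ge_ge i.1 j.1
    exact ⟨⟨k, i.2.trans hik⟩, hik, hjk⟩⟩
  have hcard : Cardinal.mk (Set.Ici i₀) ≤ Cardinal.lift.{u} κ :=
    (Cardinal.mk_set_le _).trans S.card_le
  have hZ' (i j : Set.Ici i₀) (h : i < j) : ∃ (P : ProObj D κ) (d : Z.obj j ⟶ P),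
      Conflation (Z.map (homOfLE h.le)) d ∧ C.map (toPro D κ) P := by
    obtain ⟨Q, q, hc, hQ⟩ := hq i.1 j.1 h
    obtain ⟨d, hd⟩ := hquot i j h.le Q q hc
    exact ⟨Q, d, hd, hQ⟩
  have hZ {i j : Set.Ici i₀} (a : i ⟶ j) : AdmMono (Z.map a) := by
    obtain ⟨Q, q, hc⟩ := S.admMono (homOfLE (leOfHom a) : i.1 ⟶ j.1)
    obtain ⟨d, hd⟩ := hquot i j (leOfHom a) Q q hc
    exact ⟨Q, d, hd⟩
  have hZC (j : Set.Ici i₀) : C.map (toPro D κ) (Z.obj j) := by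
    have := (hg j).epi
    -- At the bottom index the quotient is zero, a case that the condition on strict inequalities
    -- does not cover.
    obtain hj | hj := (show i₀ ≤ j.1 from j.2).eq_or_lt
    · obtain ⟨j, hj'⟩ := j
      obtain rfl : i₀ = j := hj
      have hz : IsZero (Z.obj ⟨i₀, hj'⟩) := by
        rw [IsZero.iff_id_eq_zero, ← cancel_epi (g ⟨i₀, hj'⟩)]
        have h0 := (hg ⟨i₀, hj'⟩).zero
        rw [show (homOfLE _ : i₀ ⟶ i₀) = 𝟙 i₀ from rfl, CategoryTheory.Functor.map_id,
          Category.id_comp] at h0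
        rw [h0, zero_comp, zero_comp]
      obtain ⟨O, hO⟩ := HasZeroObject.zero (C := D)
      have hO' : IsZero ((toPro D κ).obj O) := (isZero_toInd (κ := κ) hO.op).op
      exact (C.prop_map_iff (toPro D κ) _).2 ⟨O, hC.zero O hO, ⟨hO'.iso hz⟩⟩
    · obtain ⟨Q, q, hc, hQ⟩ := hq i₀ j.1 hj
      have := hc.epi
      obtain ⟨a, ha⟩ := hc.desc (g j) (hg j).zero
      obtain ⟨b, hb⟩ := (hg j).desc q hc.zero
      exact (C.map (toPro D κ)).prop_of_iso ⟨a, b,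
        by rw [← cancel_epi q, reassoc_of% ha, hb, Category.comp_id],
        by rw [← cancel_epi (g j), reassoc_of% hb, ha, Category.comp_id]⟩ hQ
  let S' : AdmIndDiagram (ProObj D κ) (Cardinal.lift.{u} κ) :=
    { I := Set.Ici i₀, nonempty := ⟨⟨i₀, le_rfl⟩⟩, card_le := hcard, X := Z, admMono := hZ }
  let Q : ElTate κ C := ⟨⟨⟨G, hζ.isLeftExact⟩, ⟨S', hζ.isColimitOf⟩⟩, ⟨S', hζ.isColimitOf, hZ'⟩⟩
  exact ⟨Q, elHom ρ, conflation_el_iff.2 hρ, isIndSub_of_isUnion hC hcard hζ hZC hZ'⟩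

/-- The admissibility demanded by `SatoGr.le` is automatic, so the partial order axioms are
inherited from `Subobject V`. -/
theorem SatoGr.le_iff [IsIdempotentComplete D] {V : ElTate κ C} (L L' : SatoGr V) :
    SatoGr.le L L' ↔ L.1 ≤ L'.1 := by
  refine ⟨fun ⟨f, _, hf⟩ => Subobject.le_of_comm f hf, fun h => ?_⟩
  exact ⟨Subobject.ofLE _ _ h, admMono_of_isRelLattice L.2 L'.2 _ (Subobject.ofLE_arrow h),
    Subobject.ofLE_arrow h⟩

/-- A relative lattice as an element of the relative Sato Grassmannian. -/
def IsRelLattice.toSatoGr {L V : ElTate κ C} {i : L ⟶ V} (h : IsRelLattice i) : SatoGr V :=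
  have := h.mono
  ⟨Subobject.mk i, by
    rw [← Subobject.underlyingIso_hom_comp_eq_mk i]
    exact h.of_iso _⟩

end Tate

end RelTate

end

/-! ### Directedness of the Grassmannian. -/

theorem mainTheorem9 {D : Type u} [Category.{v} D] [Preadditive D] [RelTate.HasConflations D]
    [RelTate.QuillenExact D] [IsIdempotentComplete D]
    (C : ObjectProperty D) (hC : RelTate.IsExtensionClosed C)
    (κ : Cardinal.{v}) [Fact (Cardinal.aleph0 ≤ κ)] (V : RelTate.ElTate κ C) :
    Nonempty (RelTate.SatoGr V) ∧
      IsPartialOrder (RelTate.SatoGr V) RelTate.SatoGr.le ∧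
      IsDirected (RelTate.SatoGr V) RelTate.SatoGr.le := by
  obtain ⟨S, ι, hι, hS⟩ := RelTate.exists_lattice_diagram hC V
  refine ⟨⟨(hS (Classical.arbitrary S.I)).toSatoGr⟩,
    { refl := fun L => (RelTate.SatoGr.le_iff L L).2 le_rfl
      trans := fun L M N h h' => (RelTate.SatoGr.le_iff L N).2
        (((RelTate.SatoGr.le_iff L M).1 h).trans ((RelTate.SatoGr.le_iff M N).1 h'))
      antisymm := fun L M h h' => Subtype.ext
        (((RelTate.SatoGr.le_iff L M).1 h).antisymm ((RelTate.SatoGr.le_iff M L).1 h')) },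
    ⟨fun L M => ?_⟩⟩
  -- The inclusion of a lattice represented by `P` is a section of `V` over `P`, so it lies in one
  -- piece of the union and in all later ones; directedness of the index set then bounds two
  -- lattices at once.
  have key (L : RelTate.SatoGr V) : ∃ i, ∀ j, i ≤ j →
      RelTate.SatoGr.le L (hS j).toSatoGr := by
    obtain ⟨P, ⟨e⟩⟩ := L.2.1
    obtain ⟨i, x, hx⟩ := hι.exists_ap P
      (RelTate.ap (e.hom ≫ RelTate.elPsh L.1.arrow) (𝟙 P))
    refine ⟨i, fun j hij => (RelTate.SatoGr.le_iff _ _).2 ?_⟩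
    have := (hS j).mono
    have hfac : preadditiveYoneda.map (x ≫ S.X.map (homOfLE hij)) ≫ ι j =
        e.hom ≫ RelTate.elPsh L.1.arrow := by
      refine RelTate.hom_ext_ap ?_
      rw [RelTate.ap_map, Category.id_comp, hι.ap_map, hx]
    refine Subobject.le_mk_of_comm (RelTate.elHom (Y := RelTate.elRep κ C (S.X.obj j))
      (e.inv ≫ preadditiveYoneda.map (x ≫ S.X.map (homOfLE hij)))) (RelTate.elHom_ext ?_)
    change (e.inv ≫ preadditiveYoneda.map (x ≫ S.X.map (homOfLE hij))) ≫ ι j = _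
    rw [Category.assoc, hfac, e.inv_hom_id_assoc]
  obtain ⟨i, hi⟩ := key L
  obtain ⟨j, hj⟩ := key M
  obtain ⟨k, hik, hjk⟩ := exists_ge_ge i j
  exact ⟨_, hi k hik, hj k hjk⟩
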